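/- Let $f:\mathbb R^n\to\mathbb R$ be quadratic at infinity, that is, $f$ is continuous and there is a nondegenerate quadratic form $Q$ on $\mathbb R^n$ such that $f=Q$ outside a compact set. Let $\lambda$ be the Morse index of $Q$ (the maximal dimension of a linear subspace on which $Q$ is negative definite), write $X=\mathbb R^n$ and $f^c=\{x\in X: f(x)\le c\}$, and let $f^{\infty}$ and $f^{-\infty}$ stand for $f^{b}$ and $f^{-b}$ with $b$ sufficiently large. For a ring $R$ (with unit), using relative singular homology with coefficients in $R$ and the homomorphisms induced by inclusions of pairs, define the minmax and the maxmin of $f$ by $$m(f,R)=\inf\{c\in\mathbb R:\ H_\lambda(f^c,f^{-\infty};R)\to H_\lambda(f^{\infty},f^{-\infty};R)\text{ is onto}\},$$ $$s(f,R)=\sup\{c\in\mathbb R:\ H_{n-\lambda}(X\setminus f^c,X\setminus f^{\infty};R)\to H_{n-\lambda}(X\setminus f^{-\infty},X\setminus f^{\infty};R)\text{ is onto}\},$$ the infimum and the supremum being taken in $[-\infty,+\infty]$. Then for every ring $R$, $$m(f,\mathbb Z)\ \ge\ m(f,R)\qquad\text{and}\qquad s(f,\mathbb Z)\ \le\ s(f,R).$$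 -/

import Mathlib

open CategoryTheory Limits Filter

universe u

noncomputable section

namespace MinMax

/-- The functor sending a topological pair `(X, A)` to its relative singular chain complex
`C(X; R) / C(A; R)`, the cokernel of the map of singular chain complexes with coefficients
in `R` that is induced by the embedding `A ⟶ X`. -/
def relSingularChainComplex (R : Type u) [Ring R] : TopPair.{0} ⥤ ChainComplex (ModuleCat.{u} R) ℕ :=
  MorphismProperty.Arrow.forget _ _ _ ⋙
    ((AlgebraicTopology.singularChainComplexFunctor (ModuleCat.{u} R)).obj
      (ModuleCat.of R R)).mapArrow ⋙ coker _

/-- The relative singular homology functor `(X, A) ↦ H_k(X, A; R)`. -/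
def relSingularHomology (R : Type u) [Ring R] (k : ℕ) : TopPair.{0} ⥤ ModuleCat.{u} R :=
  relSingularChainComplex R ⋙ HomologicalComplex.homologyFunctor _ _ k

/-- The topological pair `(B, A)` of two subsets `A ⊆ B` of a space `X`. -/
def subsetPair {X : Type} [TopologicalSpace X] {A B : Set X} (hAB : A ⊆ B) : TopPair.{0} :=
  TopPair.of (A := TopCat.of A) (X := TopCat.of B)
    (TopCat.ofHom ⟨Set.inclusion hAB, continuous_inclusion hAB⟩)
    (Topology.IsEmbedding.inclusion hAB)

/-- The inclusion of pairs `(B, A) ↪ (B', A)` for `A ⊆ B ⊆ B'`. -/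
def subsetPairInclusion {X : Type} [TopologicalSpace X] {A B B' : Set X} (hAB : A ⊆ B) (hBB' : B ⊆ B') :
    subsetPair hAB ⟶ subsetPair (hAB.trans hBB') :=
  TopPair.ofHom (X := subsetPair hAB) (Y := subsetPair (hAB.trans hBB'))
    (TopCat.ofHom ⟨Set.inclusion hBB', continuous_inclusion hBB'⟩) (𝟙 (TopCat.of A)) rfl

/-- The homomorphism `H_k(B, A; R) → H_k(B', A; R)` induced by `(B, A) ↪ (B', A)`. -/
def relHomologyMap (R : Type u) [Ring R] (k : ℕ) {X : Type} [TopologicalSpace X]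
    {A B B' : Set X} (hAB : A ⊆ B) (hBB' : B ⊆ B') :
    (relSingularHomology R k).obj (subsetPair hAB) →ₗ[R]
      (relSingularHomology R k).obj (subsetPair (hAB.trans hBB')) :=
  ((relSingularHomology R k).map (subsetPairInclusion hAB hBB')).hom

/-- The sublevel set `f ^ c = {x | f x ≤ c}`. -/
def sublevel {X : Type} (f : X → ℝ) (c : ℝ) : Set X := {x | f x ≤ c}

theorem sublevel_subset {X : Type} (f : X → ℝ) {a b : ℝ} (h : a ≤ b) : sublevel f a ⊆ sublevel f b :=
  fun _ hx => le_trans hx h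

theorem compl_sublevel_subset {X : Type} (f : X → ℝ) {a b : ℝ} (h : a ≤ b) :
    (sublevel f b)ᶜ ⊆ (sublevel f a)ᶜ :=
  Set.compl_subset_compl.2 (sublevel_subset f h)

/-- `f` is quadratic at infinity with reference form `Q`: it is continuous, `Q` is nondegenerate,
and `f` coincides with `Q` outside a compact set. -/
structure IsQuadraticAtInfinity {n : ℕ} (f : EuclideanSpace ℝ (Fin n) → ℝ)
    (Q : QuadraticForm ℝ (EuclideanSpace ℝ (Fin n))) : Prop where
  continuous : Continuous f
  nondegenerate : Q.Nondegenerate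
  eq_outside : ∃ K : Set (EuclideanSpace ℝ (Fin n)), IsCompact K ∧ ∀ x ∉ K, f x = Q x

/-- The real numbers `c` such that `H_k(f ^ c, f ^ (-∞); R) → H_k(f ^ ∞, f ^ (-∞); R)` is onto.
Here `f ^ ∞` and `f ^ (-∞)` stand for `f ^ b` and `f ^ (-b)` with `b` sufficiently large. -/
def minmaxLevels (R : Type u) [Ring R] (k : ℕ) {X : Type} [TopologicalSpace X]
    (f : X → ℝ) : Set ℝ :=
  {c | ∀ᶠ b : ℝ in atTop, ∃ (h₁ : -b ≤ c) (h₂ : c ≤ b),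
    Function.Surjective
      (relHomologyMap R k (sublevel_subset f h₁) (sublevel_subset f h₂))}

/-- The real numbers `c` such that
`H_k(X \ f ^ c, X \ f ^ ∞; R) → H_k(X \ f ^ (-∞), X \ f ^ ∞; R)` is onto, with the same
convention for `f ^ ∞` and `f ^ (-∞)`. -/
def maxminLevels (R : Type u) [Ring R] (k : ℕ) {X : Type} [TopologicalSpace X]
    (f : X → ℝ) : Set ℝ :=
  {c | ∀ᶠ b : ℝ in atTop, ∃ (h₁ : -b ≤ c) (h₂ : c ≤ b),
    Function.Surjective
      (relHomologyMap R k (compl_sublevel_subset f h₂) (compl_sublevel_subset f h₁))}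

/-- The minmax `m(f, R)` of a function `f` that is quadratic at infinity with reference form `Q`.
The degree is the Morse index of `Q`, the maximal dimension of a negative definite subspace.
The infimum is taken in the extended real line. -/
def minmax (R : Type u) [Ring R] {n : ℕ} (Q : QuadraticForm ℝ (EuclideanSpace ℝ (Fin n)))
    (f : EuclideanSpace ℝ (Fin n) → ℝ) : EReal :=
  sInf (Real.toEReal '' minmaxLevels R (sigNeg Q) f)

/-- The maxmin `s(f, R)` of a function `f` that is quadratic at infinity with reference form `Q`.
The degree is `n` minus the Morse index of `Q`.
The supremum is taken in the extended real line. -/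
def maxmin (R : Type u) [Ring R] {n : ℕ} (Q : QuadraticForm ℝ (EuclideanSpace ℝ (Fin n)))
    (f : EuclideanSpace ℝ (Fin n) → ℝ) : EReal :=
  sSup (Real.toEReal '' maxminLevels R (n - sigNeg Q) f)

end MinMax

end

/-! Every level that is admissible over `ℤ` is admissible over `R`; enlarging the set of levels
lowers the infimum and raises the supremum. For large `b` the sets at levels `±b` are those of `Q`.
Put `B' = {Q ≤ b}`, `A = {Q ≤ -b}`. By universal coefficients the cokernel of `H_λ(B', A; ℤ) ⊗ R →
H_λ(B', A; R)` is `Tor(H_{λ-1}(B', A; ℤ), R)`. As `H_{λ-1}(B', A; ℤ) = 0`, right exactness of the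
tensor product carries surjectivity from `ℤ` to `R`. The maxmin is the same statement for `-Q`,
whose index is `n - λ`.

The Tor argument is run on chains (`RelSurjective.of_int_succ`) and sees only the additive group of
`R`. Smith normal form writes an `R`-chain as `∑ c_j g_j` with integral `c_j` and no relations among
the `g_j` except those generated by `a_j g_j = 0`. For a relative cycle, `a_j` divides `∂c_j`
outside `A`. The quotient is an integral relative cycle of degree `λ - 1`, hence a relative boundary
`∂e_j`, and `c_j - a_j e_j` is an integral relative cycle with the same contribution.

For the vanishing (`IsExteriorLike.exists_sub_boundary_mem`), `B'` is star-shaped and `A` behaves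
like the exterior of a ball in `ℝ^λ`. A boundary of dimension below `λ - 1` is projected to `ℝ^λ`
and made polynomial by a Bernstein operation compatible with faces. A dimension count gives a point
`q` to which it can be coned without meeting `0`, and the cone is scaled outwards into `A`
(`IsExteriorLike.exists_boundary_eq`). -/

namespace MinMax

open Simplicial

/-! ### Simplicial chains as finitely supported functions. -/

section Chains

variable (R : Type u) [Ring R] (X Y : SSet.{0})

/-- The simplicial chain complex of `X` with coefficients in the ring `R`. -/
noncomputable abbrev simplicialChains : ChainComplex (ModuleCat.{u} R) ℕ :=
  X.chainComplex (ModuleCat.of R R)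

variable {X Y} in
/-- The inclusion of the summand indexed by a simplex. -/
noncomputable def simplexInclusion {n : ℕ} (x : X _⦋n⦌) : R →ₗ[R] (simplicialChains R X).X n :=
  (X.ιChainComplex (R := ModuleCat.of R R) x).hom

variable {R X} in
lemma simplicialChains_hom_ext {n : ℕ} {M : Type u} [AddCommGroup M] [Module R M]
    {f g : (simplicialChains R X).X n →ₗ[R] M}
    (h : ∀ x r, f (simplexInclusion R x r) = g (simplexInclusion R x r)) : f = g := by
  refine congrArg ModuleCat.Hom.hom (a₁ := ModuleCat.ofHom f) (a₂ := ModuleCat.ofHom g)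
    (SSet.chainComplex_hom_ext fun x => ?_)
  ext
  exact h x 1

/-- A chain as a finitely supported function on simplices. -/
noncomputable def chainsToFinsupp (n : ℕ) :
    (simplicialChains R X).X n →ₗ[R] (X _⦋n⦌ →₀ R) :=
  ((X.isColimitChainComplexXCofan (ModuleCat.of R R) n).desc
    (Cofan.mk (ModuleCat.of R (X _⦋n⦌ →₀ R)) fun x => ModuleCat.ofHom (Finsupp.lsingle x))).hom

variable {X Y} in
lemma chainsToFinsupp_simplexInclusion {n : ℕ} (x : X _⦋n⦌) (r : R) :
    chainsToFinsupp R X n (simplexInclusion R x r) = Finsupp.single x r :=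
  ConcreteCategory.congr_hom ((X.isColimitChainComplexXCofan (ModuleCat.of R R) n).fac
    (Cofan.mk (ModuleCat.of R (X _⦋n⦌ →₀ R)) fun x => ModuleCat.ofHom (Finsupp.lsingle x)) ⟨x⟩) r

/-- The simplicial chains of `X` as finitely supported functions on simplices. -/
noncomputable def chainsEquiv (n : ℕ) :
    (simplicialChains R X).X n ≃ₗ[R] (X _⦋n⦌ →₀ R) :=
  LinearEquiv.ofLinearMap (chainsToFinsupp R X n) (Finsupp.lsum ℕ fun x => simplexInclusion R x)
    (Finsupp.lhom_ext fun x r => by simp [chainsToFinsupp_simplexInclusion])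
    (simplicialChains_hom_ext fun x r => by simp [chainsToFinsupp_simplexInclusion])

variable {X Y}

lemma chainsEquiv_symm_single {n : ℕ} (x : X _⦋n⦌) (r : R) :
    (chainsEquiv R X n).symm (Finsupp.single x r) = simplexInclusion R x r := by
  simp [chainsEquiv]

variable (X) in
/-- The boundary operator on finitely supported functions on simplices. -/
noncomputable def boundary (n : ℕ) : (X _⦋n + 1⦌ →₀ R) →ₗ[R] (X _⦋n⦌ →₀ R) :=
  ∑ i : Fin (n + 2), (-1 : ℤ) ^ (i : ℕ) • Finsupp.lmapDomain R R (X.δ i)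

lemma boundary_single {n : ℕ} (x : X _⦋n + 1⦌) (r : R) :
    boundary R X n (Finsupp.single x r) =
      ∑ i : Fin (n + 2), (-1 : ℤ) ^ (i : ℕ) • Finsupp.single (X.δ i x) r := by
  simp [boundary, Finsupp.mapDomain_single]

lemma chainsEquiv_d {n : ℕ} (c : (simplicialChains R X).X (n + 1)) :
    chainsEquiv R X n (((simplicialChains R X).d (n + 1) n).hom c) =
      boundary R X n (chainsEquiv R X (n + 1) c) := by
  obtain ⟨c, rfl⟩ := (chainsEquiv R X (n + 1)).symm.surjective c
  rw [LinearEquiv.apply_symm_apply, ← LinearEquiv.eq_symm_apply]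
  induction c using Finsupp.induction_linear with
  | zero => simp
  | add c d hc hd => simp only [map_add, hc, hd]
  | single x r =>
    rw [chainsEquiv_symm_single, boundary_single]
    simp only [map_sum, map_zsmul, chainsEquiv_symm_single]
    refine (ConcreteCategory.congr_hom (SSet.ιChainComplex_d X (ModuleCat.of R R) x) r).trans ?_
    simp [simplexInclusion]

lemma chainsEquiv_map (f : X ⟶ Y) {n : ℕ} (c : (simplicialChains R X).X n) :
    chainsEquiv R Y n (((SSet.chainComplexMap f (ModuleCat.of R R)).f n).hom c) =
      Finsupp.mapDomain (f.app (.op ⦋n⦌)) (chainsEquiv R X n c) := by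
  obtain ⟨c, rfl⟩ := (chainsEquiv R X n).symm.surjective c
  rw [LinearEquiv.apply_symm_apply, ← LinearEquiv.eq_symm_apply]
  induction c using Finsupp.induction_linear with
  | zero => simp
  | add c d hc hd => simp only [map_add, hc, hd, Finsupp.mapDomain_add]
  | single x r =>
    rw [chainsEquiv_symm_single, Finsupp.mapDomain_single, chainsEquiv_symm_single]
    exact ConcreteCategory.congr_hom (SSet.ι_chainComplexMap_f (X := X) (Y := Y) f (ModuleCat.of R R) x) r

lemma boundary_boundary {n : ℕ} (c : X _⦋n + 2⦌ →₀ R) :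
    boundary R X n (boundary R X (n + 1) c) = 0 := by
  obtain ⟨c, rfl⟩ := (chainsEquiv R X (n + 2)).surjective c
  rw [← chainsEquiv_d, ← chainsEquiv_d]
  have := ConcreteCategory.congr_hom
    ((simplicialChains R X).d_comp_d (n + 2) (n + 1) n) c
  rw [ModuleCat.comp_apply] at this
  rw [this]
  simp

lemma boundary_mapDomain (f : X ⟶ Y) {n : ℕ} (c : X _⦋n + 1⦌ →₀ R) :
    boundary R Y n (Finsupp.mapDomain (f.app (.op ⦋n + 1⦌)) c) =
      Finsupp.mapDomain (f.app (.op ⦋n⦌)) (boundary R X n c) := by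
  induction c using Finsupp.induction_linear with
  | zero => simp
  | add c d hc hd => simp only [map_add, hc, hd, Finsupp.mapDomain_add]
  | single x r =>
    rw [Finsupp.mapDomain_single, boundary_single, boundary_single, Finsupp.mapDomain_finsetSum]
    refine Finset.sum_congr rfl fun i _ => ?_
    rw [← Finsupp.mapDomain.addMonoidHom_apply, map_zsmul, Finsupp.mapDomain.addMonoidHom_apply,
      Finsupp.mapDomain_single]
    congr 2
    exact (SSet.δ_naturality_apply f i x).symm

/-- The prism operator of a combinatorial simplicial homotopy. -/
noncomputable def prism {f g : X ⟶ Y} (H : SimplicialObject.Homotopy f g) (n : ℕ) :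
    (X _⦋n⦌ →₀ R) →ₗ[R] (Y _⦋n + 1⦌ →₀ R) :=
  -∑ i : Fin (n + 1), (-1 : ℤ) ^ (i : ℕ) • Finsupp.lmapDomain R R (H.h i)

lemma prism_single {f g : X ⟶ Y} (H : SimplicialObject.Homotopy f g) {n : ℕ} (x : X _⦋n⦌)
    (r : R) :
    prism R H n (Finsupp.single x r) =
      -∑ i : Fin (n + 1), (-1 : ℤ) ^ (i : ℕ) • Finsupp.single (H.h i x) r := by
  simp [prism, Finsupp.mapDomain_single]

/-- Matches `prism`, minus sign included, with the categorical chain homotopy of `H`, so the prism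
formulas below are its relation `comm` and need no sign computation. -/
lemma chainsEquiv_hom {f g : X ⟶ Y} (H : SimplicialObject.Homotopy f g) {n : ℕ}
    (c : (simplicialChains R X).X n) :
    chainsEquiv R Y (n + 1) (((H.sSetChainComplexMap (ModuleCat.of R R)).hom n (n + 1)).hom c) =
      prism R H n (chainsEquiv R X n c) := by
  obtain ⟨c, rfl⟩ := (chainsEquiv R X n).symm.surjective c
  rw [LinearEquiv.apply_symm_apply, ← LinearEquiv.eq_symm_apply]
  induction c using Finsupp.induction_linear with
  | zero => simp
  | add c d hc hd => simp only [map_add, hc, hd]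
  | single x r =>
    rw [chainsEquiv_symm_single, prism_single]
    simp only [map_neg, map_sum, map_zsmul, chainsEquiv_symm_single]
    have key : (H.sSetChainComplexMap (ModuleCat.of R R)).hom n (n + 1) =
      -∑ k : Fin (n + 1), ((-1 : ℤ) ^ (k : ℕ)) •
        (sigmaConst.obj (ModuleCat.of R R)).map (H.h k) :=
      SimplicialObject.Homotopy.ToChainHomotopy.hom_eq _ _
    have key2 (k : Fin (n + 1)) : X.ιChainComplex x ≫
        (sigmaConst.obj (ModuleCat.of R R)).map (H.h k) =
        Y.ιChainComplex (R := ModuleCat.of R R) (H.h k x) := by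
      refine (Sigma.ι_comp_map' _ _ _).trans ?_
      simp [SSet.ιChainComplex]
    have comp_neg_sum {A B C : ModuleCat.{u} R} (φ : A ⟶ B) (ψ : Fin (n + 1) → (B ⟶ C)) :
        φ ≫ (-∑ k : Fin (n + 1), ((-1 : ℤ) ^ (k : ℕ)) • ψ k) = -∑ k : Fin (n + 1), ((-1 : ℤ) ^ (k : ℕ)) • φ ≫ ψ k := by
      simp [Preadditive.comp_sum]
    have key3 : X.ιChainComplex x ≫ (H.sSetChainComplexMap (ModuleCat.of R R)).hom n (n + 1) =
        -∑ k : Fin (n + 1), ((-1 : ℤ) ^ (k : ℕ)) •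
          Y.ιChainComplex (R := ModuleCat.of R R) (H.h k x) := by
      rw [key]
      simp only [← key2]
      exact comp_neg_sum _ _
    refine (ConcreteCategory.congr_hom key3 r).trans ?_
    simp [simplexInclusion]

lemma boundary_prism_zero {f g : X ⟶ Y} (H : SimplicialObject.Homotopy f g)
    (c : X _⦋0⦌ →₀ R) :
    Finsupp.mapDomain (f.app (.op ⦋0⦌)) c =
      boundary R Y 0 (prism R H 0 c) + Finsupp.mapDomain (g.app (.op ⦋0⦌)) c := by
  obtain ⟨c, rfl⟩ := (chainsEquiv R X 0).surjective c
  rw [← chainsEquiv_hom, ← chainsEquiv_map, ← chainsEquiv_map, ← chainsEquiv_d, ← map_add]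
  have := ConcreteCategory.congr_hom ((H.sSetChainComplexMap (ModuleCat.of R R)).comm 0) c
  rw [Homotopy.prevD_chainComplex, Homotopy.dNext_zero_chainComplex] at this
  rw [this]
  simp

lemma boundary_prism_succ {f g : X ⟶ Y} (H : SimplicialObject.Homotopy f g) {n : ℕ}
    (c : X _⦋n + 1⦌ →₀ R) :
    Finsupp.mapDomain (f.app (.op ⦋n + 1⦌)) c =
      prism R H n (boundary R X n c) + boundary R Y (n + 1) (prism R H (n + 1) c) +
        Finsupp.mapDomain (g.app (.op ⦋n + 1⦌)) c := by
  obtain ⟨c, rfl⟩ := (chainsEquiv R X (n + 1)).surjective c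
  rw [← chainsEquiv_d, ← chainsEquiv_hom, ← chainsEquiv_hom, ← chainsEquiv_map, ← chainsEquiv_map,
    ← chainsEquiv_d, ← map_add, ← map_add]
  have := ConcreteCategory.congr_hom ((H.sSetChainComplexMap (ModuleCat.of R R)).comm (n + 1)) c
  rw [Homotopy.prevD_chainComplex, Homotopy.dNext_succ_chainComplex] at this
  rw [this]
  simp

end Chains

end MinMax

namespace MinMax

open Simplicial

/-! ### Homology and cokernels in terms of elements. -/

section Homology

variable {R : Type u} [Ring R]

lemma homologyι_eq_pOpcycles_of_iCycles_eq (S : ShortComplex (ModuleCat.{u} R)) (c : S.cycles) :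
    S.homologyι (S.homologyπ c) = S.pOpcycles (S.iCycles c) := by
  rw [← ModuleCat.comp_apply, ← ModuleCat.comp_apply, S.homology_π_ι]

lemma exists_homologyι_eq_of_cycle (S : ShortComplex (ModuleCat.{u} R)) (z : S.X₂)
    (hz : S.g z = 0) : ∃ h : S.homology, S.homologyι h = S.pOpcycles z := by
  let z' : S.moduleCatLeftHomologyData.K := (⟨z, hz⟩ : LinearMap.ker S.g.hom)
  refine ⟨S.homologyπ (S.moduleCatCyclesIso.inv z'), ?_⟩
  rw [homologyι_eq_pOpcycles_of_iCycles_eq, S.moduleCatCyclesIso_inv_iCycles_apply]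
  rfl

lemma exists_cycle_of_homology (S : ShortComplex (ModuleCat.{u} R)) (h : S.homology) :
    ∃ z : S.X₂, S.g z = 0 ∧ S.homologyι h = S.pOpcycles z := by
  obtain ⟨c, rfl⟩ := (ModuleCat.epi_iff_surjective S.homologyπ).1 inferInstance h
  refine ⟨S.iCycles c, ?_, homologyι_eq_pOpcycles_of_iCycles_eq S c⟩
  rw [← ModuleCat.comp_apply, S.iCycles_g]
  simp

/-- Homology embeds in opcycles by `homologyι`, so two cycles have the same class exactly when they
differ by an element of the image of `f`. -/
lemma surjective_homologyMap_iff {S₁ S₂ : ShortComplex (ModuleCat.{u} R)} (φ : S₁ ⟶ S₂) :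
    Function.Surjective (ShortComplex.homologyMap φ) ↔
      ∀ z : S₂.X₂, S₂.g z = 0 → ∃ w : S₁.X₂, S₁.g w = 0 ∧ ∃ y : S₂.X₁, z - φ.τ₂ w = S₂.f y := by
  have inj : Function.Injective S₂.homologyι :=
    (ModuleCat.mono_iff_injective S₂.homologyι).1 inferInstance
  have nat (h : S₁.homology) (w : S₁.X₂) (hw : S₁.homologyι h = S₁.pOpcycles w) :
      S₂.homologyι (ShortComplex.homologyMap φ h) = S₂.pOpcycles (φ.τ₂ w) := by
    rw [← ModuleCat.comp_apply, ShortComplex.homologyι_naturality, ModuleCat.comp_apply, hw,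
      ← ModuleCat.comp_apply, ShortComplex.p_opcyclesMap, ModuleCat.comp_apply]
  constructor
  · intro hs z hz
    obtain ⟨h, hh⟩ := exists_homologyι_eq_of_cycle S₂ z hz
    obtain ⟨k, rfl⟩ := hs h
    obtain ⟨w, hw, hkw⟩ := exists_cycle_of_homology S₁ k
    rw [nat k w hkw] at hh
    obtain ⟨y, hy⟩ := (ShortComplex.moduleCat_pOpcycles_eq_iff S₂ _ _).1 hh.symm
    exact ⟨w, hw, y, hy.symm⟩
  · intro H h
    obtain ⟨z, hz, hhz⟩ := exists_cycle_of_homology S₂ h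
    obtain ⟨w, hw, y, hy⟩ := H z hz
    obtain ⟨k, hk⟩ := exists_homologyι_eq_of_cycle S₁ w hw
    refine ⟨k, inj ?_⟩
    rw [nat k w hk, hhz]
    exact ((ShortComplex.moduleCat_pOpcycles_eq_iff S₂ _ _).2 ⟨y, hy.symm⟩).symm

lemma cokernel_π_f_surjective {K L : ChainComplex (ModuleCat.{u} R) ℕ} (f : K ⟶ L) (n : ℕ) :
    Function.Surjective ((cokernel.π f).f n) :=
  (ModuleCat.epi_iff_surjective ((cokernel.π f).f n)).1 inferInstance

lemma cokernel_π_f_eq_zero_iff {K L : ChainComplex (ModuleCat.{u} R) ℕ} (f : K ⟶ L) {n : ℕ}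
    (x : L.X n) : (cokernel.π f).f n x = 0 ↔ ∃ y, f.f n y = x := by
  have h : (ShortComplex.mk f (cokernel.π f) (cokernel.condition f)).Exact :=
    ShortComplex.exact_cokernel f
  have h' := h.map_of_preservesRightHomologyOf
    (HomologicalComplex.eval (ModuleCat.{u} R) (ComplexShape.down ℕ) n)
  constructor
  · exact fun hx => (ShortComplex.moduleCat_exact_iff _).1 h' x hx
  · rintro ⟨y, rfl⟩
    rw [← ModuleCat.comp_apply, ← HomologicalComplex.comp_f, cokernel.condition]
    simp

end Homology

end MinMax

namespace MinMax

open Simplicial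

/-! ### Relative singular homology of subsets through chains of one ambient space. -/

section SingularSet

/-- The singular simplicial set of a topological space, with simplices the continuous maps from
the standard simplex. -/
noncomputable def singularSet (V : Type) [TopologicalSpace V] : SSet.{0} :=
  SimplexCategory.toTop₀.op ⋙ yoneda.obj (TopCat.of V)

variable {V : Type} [TopologicalSpace V]

/-- The underlying continuous map of a singular simplex. -/
noncomputable def toCMap {n : SimplexCategoryᵒᵖ} (σ : (singularSet V).obj n) :
    C(stdSimplex ℝ (Fin (n.unop.len + 1)), V) := TopCat.Hom.hom (X := .of _) (Y := .of V) σ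

/-- The singular simplex given by a continuous map. -/
noncomputable def ofCMap {n : SimplexCategoryᵒᵖ}
    (σ : C(stdSimplex ℝ (Fin (n.unop.len + 1)), V)) : (singularSet V).obj n :=
  TopCat.ofHom σ

lemma simplex_ext {n : SimplexCategoryᵒᵖ} {σ τ : (singularSet V).obj n}
    (h : ∀ x, toCMap σ x = toCMap τ x) : σ = τ :=
  TopCat.hom_ext (X := .of _) (Y := .of V) (ContinuousMap.ext h)

lemma toCMap_map_apply {m n : SimplexCategoryᵒᵖ} (f : m ⟶ n) (σ : (singularSet V).obj m)
    (x : stdSimplex ℝ (Fin (n.unop.len + 1))) :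
    toCMap ((singularSet V).map f σ) x = toCMap σ (stdSimplex.map f.unop.toOrderHom x) := rfl

/-- The simplices of `V` with image in `B`. -/
def simplicesIn (B : Set V) (n : ℕ) : Set ((singularSet V) _⦋n⦌) :=
  {σ | ∀ x, toCMap σ x ∈ B}

variable (R : Type u) [Ring R]

/-- The singular chains of `V` with coefficients in `R` supported on simplices in `B`. -/
noncomputable def chainsIn (B : Set V) (n : ℕ) : Submodule R ((singularSet V) _⦋n⦌ →₀ R) :=
  Finsupp.supported R R (simplicesIn B n)

/-- The map of simplicial sets from the singular set of a subspace to the one of the space. -/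
noncomputable def subspaceToSingularSet (B : Set V) :
    TopCat.toSSet.obj (TopCat.of B) ⟶ singularSet V where
  app n := TypeCat.ofHom fun σ => ofCMap
    (ContinuousMap.comp ⟨Subtype.val, continuous_subtype_val⟩ (TopCat.toSSetObjEquiv _ n σ))
  naturality m n f := ConcreteCategory.hom_ext _ _ fun σ => simplex_ext fun x => rfl

lemma subspaceToSingularSet_injective (B : Set V) (n : ℕ) :
    Function.Injective ((subspaceToSingularSet B).app (.op ⦋n⦌)) := by
  intro σ τ h
  refine (TopCat.toSSetObjEquiv _ _).injective (ContinuousMap.ext fun x => Subtype.ext ?_)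
  exact congrArg (fun ρ => toCMap ρ x) h

lemma range_subspaceToSingularSet (B : Set V) (n : ℕ) :
    Set.range ((subspaceToSingularSet B).app (.op ⦋n⦌)) = simplicesIn B n := by
  ext σ
  constructor
  · rintro ⟨τ, rfl⟩ x
    exact (TopCat.toSSetObjEquiv (TopCat.of B) _ τ x).2
  · intro h
    refine ⟨(TopCat.toSSetObjEquiv (TopCat.of B) (.op ⦋n⦌)).symm
      ⟨fun x => ⟨toCMap σ x, h x⟩, (toCMap σ).continuous.subtype_mk _⟩, ?_⟩
    refine simplex_ext fun x => ?_
    change ((TopCat.toSSetObjEquiv (TopCat.of B) (.op ⦋n⦌) _ x : B) : V) = _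
    rw [Equiv.apply_symm_apply]
    rfl

/-- The singular chains of a subspace, as chains of the ambient space. -/
noncomputable def ambientChain (B : Set V) (n : ℕ) :
    (simplicialChains R (TopCat.toSSet.obj (TopCat.of B))).X n →ₗ[R]
      ((singularSet V) _⦋n⦌ →₀ R) :=
  Finsupp.lmapDomain R R ((subspaceToSingularSet B).app (.op ⦋n⦌)) ∘ₗ (chainsEquiv R _ n).toLinearMap

lemma ambientChain_injective (B : Set V) (n : ℕ) : Function.Injective (ambientChain R B n) :=
  (Finsupp.mapDomain_injective (subspaceToSingularSet_injective B n)).comp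
    (chainsEquiv R _ n).injective

lemma range_ambientChain (B : Set V) (n : ℕ) :
    LinearMap.range (ambientChain R B n) = chainsIn R B n := by
  rw [ambientChain, LinearMap.range_comp, LinearEquiv.range, ← Finsupp.supported_univ,
    Finsupp.lmapDomain_supported, Set.image_univ, range_subspaceToSingularSet, chainsIn]

lemma ambientChain_mem (B : Set V) (n : ℕ) (c) : ambientChain R B n c ∈ chainsIn R B n := by
  rw [← range_ambientChain]
  exact ⟨c, rfl⟩

lemma exists_ambientChain_eq {B : Set V} {n : ℕ} {c} (hc : c ∈ chainsIn R B n) :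
    ∃ c', ambientChain R B n c' = c := by
  rwa [← range_ambientChain] at hc

lemma ambientChain_d (B : Set V) (n : ℕ) (c) :
    ambientChain R B n (((simplicialChains R _).d (n + 1) n).hom c) =
      boundary R _ n (ambientChain R B (n + 1) c) := by
  simp only [ambientChain, LinearMap.comp_apply, LinearEquiv.coe_coe, chainsEquiv_d]
  exact (boundary_mapDomain R (subspaceToSingularSet B) _).symm

lemma ambientChain_map {A B : Set V} (h : A ⊆ B) (n : ℕ) (c) :
    ambientChain R B n (((SSet.chainComplexMap (TopCat.toSSet.map
      (TopCat.ofHom ⟨Set.inclusion h, continuous_inclusion h⟩)) (ModuleCat.of R R)).f n).hom c) =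
      ambientChain R A n c := by
  simp only [ambientChain, LinearMap.comp_apply, LinearEquiv.coe_coe, chainsEquiv_map]
  change Finsupp.mapDomain _ (Finsupp.mapDomain _ _) = Finsupp.mapDomain _ _
  rw [← Finsupp.mapDomain_comp]
  rfl

/-- Chains whose boundary lies in `A`. -/
def IsRelCycle (A : Set V) (n : ℕ) (c : (singularSet V) _⦋n⦌ →₀ R) : Prop :=
  match n, c with
  | 0, _ => True
  | n + 1, c => boundary R _ n c ∈ chainsIn R A n

/-- Every cycle of `(B', A)` in degree `n` is homologous to a cycle of `(B, A)`. -/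
def RelSurjective (A B B' : Set V) (n : ℕ) : Prop :=
  ∀ z ∈ chainsIn R B' n, IsRelCycle R A n z → ∃ w ∈ chainsIn R B n, IsRelCycle R A n w ∧
    ∃ y ∈ chainsIn R B' (n + 1), z - w - boundary R _ n y ∈ chainsIn R A n

lemma sc_g_eq_zero_iff (K : ChainComplex (ModuleCat.{u} R) ℕ) (n : ℕ) (z : K.X (n + 1)) :
    (K.sc (n + 1)).g z = 0 ↔ K.d (n + 1) n z = 0 := by
  have h := ChainComplex.next_nat_succ n
  change K.d (n + 1) ((ComplexShape.down ℕ).next (n + 1)) z = 0 ↔ _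
  rw [h]

lemma sc_zero_g (K : ChainComplex (ModuleCat.{u} R) ℕ) (z : K.X 0) : (K.sc 0).g z = 0 := by
  change K.d 0 ((ComplexShape.down ℕ).next 0) z = 0
  rw [K.shape _ _ (by simp)]
  rfl

lemma exists_sc_f_iff (K : ChainComplex (ModuleCat.{u} R) ℕ) (n : ℕ) (z : K.X n) :
    (∃ y, z = (K.sc n).f y) ↔ ∃ y : K.X (n + 1), z = K.d (n + 1) n y := by
  have h := ChainComplex.prev ℕ n
  change (∃ y : K.X ((ComplexShape.down ℕ).prev n), z = K.d _ n y) ↔ _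
  rw [h]

variable {R}

/-- The chain map from absolute to relative singular chains of a pair of subsets. -/
noncomputable def relChainMap {A B : Set V} (h : A ⊆ B) :
    simplicialChains R (TopCat.toSSet.obj (TopCat.of B)) ⟶
      (relSingularChainComplex R).obj (subsetPair h) :=
  cokernel.π (SSet.chainComplexMap (TopCat.toSSet.map
    (TopCat.ofHom ⟨Set.inclusion h, continuous_inclusion h⟩)) (ModuleCat.of R R))

/-- The map from absolute to relative singular chains of a pair of subsets. -/
noncomputable def toRelChain {A B : Set V} (h : A ⊆ B) (n : ℕ) :
    (simplicialChains R (TopCat.toSSet.obj (TopCat.of B))).X n →ₗ[R]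
      ((relSingularChainComplex R).obj (subsetPair h)).X n :=
  ((relChainMap h).f n).hom

lemma toRelChain_surjective {A B : Set V} (h : A ⊆ B) (n : ℕ) :
    Function.Surjective (toRelChain (R := R) h n) :=
  cokernel_π_f_surjective _ n

lemma toRelChain_eq_zero_iff {A B : Set V} (h : A ⊆ B) (n : ℕ) (c) :
    toRelChain (R := R) h n c = 0 ↔ ambientChain R B n c ∈ chainsIn R A n := by
  refine (cokernel_π_f_eq_zero_iff _ _).trans ⟨?_, fun hc => ?_⟩
  · rintro ⟨y, rfl⟩
    rw [ambientChain_map]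
    exact ambientChain_mem R A n y
  · obtain ⟨y, hy⟩ := exists_ambientChain_eq R hc
    refine ⟨y, ambientChain_injective R B n ?_⟩
    rw [ambientChain_map, hy]

lemma toRelChain_d {A B : Set V} (h : A ⊆ B) (n : ℕ) (c) :
    ((relSingularChainComplex R).obj (subsetPair h)).d (n + 1) n (toRelChain h (n + 1) c) =
      toRelChain h n (((simplicialChains R _).d (n + 1) n).hom c) :=
  ConcreteCategory.congr_hom ((relChainMap h).comm (n + 1) n) c

lemma toRelChain_map {A B B' : Set V} (h : A ⊆ B) (h' : B ⊆ B') (n : ℕ) (c) :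
    ((relSingularChainComplex R).map (subsetPairInclusion h h')).f n (toRelChain h n c) =
      toRelChain (h.trans h') n (((SSet.chainComplexMap (TopCat.toSSet.map
      (TopCat.ofHom ⟨Set.inclusion h', continuous_inclusion h'⟩)) (ModuleCat.of R R)).f n).hom c) := by
  have key : relChainMap h ≫ (relSingularChainComplex R).map (subsetPairInclusion h h') =
      SSet.chainComplexMap (TopCat.toSSet.map
        (TopCat.ofHom ⟨Set.inclusion h', continuous_inclusion h'⟩)) (ModuleCat.of R R) ≫
      relChainMap (h.trans h') :=
    cokernel.π_desc _ _ _
  exact ConcreteCategory.congr_hom (congrArg (fun φ => φ.f n) key) c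

lemma sc_g_toRelChain_iff {A B : Set V} (h : A ⊆ B) (n : ℕ) (c) :
    (((relSingularChainComplex R).obj (subsetPair h)).sc n).g (toRelChain h n c) = 0 ↔
      IsRelCycle R A n (ambientChain R B n c) := by
  cases n with
  | zero => exact iff_of_true (sc_zero_g R _ _) trivial
  | succ n =>
    rw [sc_g_eq_zero_iff, toRelChain_d, toRelChain_eq_zero_iff, ambientChain_d]
    rfl

/-- Absolute chains of `B` surject onto relative chains with kernel the chains in `A`. Lifting
cycles and primitives along `toRelChain` therefore replaces quotients by congruences modulo
`chainsIn R A`. -/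
theorem surjective_relHomologyMap_iff {A B B' : Set V} (h : A ⊆ B) (h' : B ⊆ B') (n : ℕ) :
    Function.Surjective (relHomologyMap R n h h') ↔ RelSurjective R A B B' n := by
  have step := surjective_homologyMap_iff ((HomologicalComplex.shortComplexFunctor
    (ModuleCat.{u} R) (ComplexShape.down ℕ) n).map
      ((relSingularChainComplex R).map (subsetPairInclusion h h')))
  refine Iff.trans step ?_
  constructor
  · intro H z hz hzc
    obtain ⟨z, rfl⟩ := exists_ambientChain_eq R hz
    obtain ⟨w, hw, hy⟩ := H (toRelChain (h.trans h') n z) ((sc_g_toRelChain_iff _ n z).2 hzc)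
    obtain ⟨w, rfl⟩ := toRelChain_surjective h n w
    obtain ⟨y, hy⟩ := (exists_sc_f_iff R _ n _).1 hy
    obtain ⟨y, rfl⟩ := toRelChain_surjective (h.trans h') (n + 1) y
    refine ⟨ambientChain R B n w, ambientChain_mem R B n w, (sc_g_toRelChain_iff _ n w).1 hw,
      ambientChain R B' (n + 1) y, ambientChain_mem R B' _ y, ?_⟩
    rw [← ambientChain_map R h', ← ambientChain_d, ← map_sub, ← map_sub,
      ← toRelChain_eq_zero_iff (h.trans h'), map_sub, map_sub, ← toRelChain_d, ← toRelChain_map,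
      sub_eq_zero]
    exact hy
  · intro H z hz
    obtain ⟨z, rfl⟩ := toRelChain_surjective (h.trans h') n z
    obtain ⟨w, hw, hwc, y, hy, hzy⟩ := H _ (ambientChain_mem R B' n z)
      ((sc_g_toRelChain_iff _ n z).1 hz)
    obtain ⟨w, rfl⟩ := exists_ambientChain_eq R hw
    obtain ⟨y, rfl⟩ := exists_ambientChain_eq R hy
    refine ⟨toRelChain h n w, (sc_g_toRelChain_iff _ n w).2 hwc, ?_⟩
    refine (exists_sc_f_iff R _ n _).2 ⟨toRelChain (h.trans h') (n + 1) y, ?_⟩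
    rw [← ambientChain_map R h', ← ambientChain_d, ← map_sub, ← map_sub,
      ← toRelChain_eq_zero_iff (h.trans h'), map_sub, map_sub, ← toRelChain_d, ← toRelChain_map,
      sub_eq_zero] at hzy
    exact hzy

end SingularSet

end MinMax

namespace MinMax

open Simplicial MonoidalCategory

/-! ### Straight-line chain homotopies. -/

section StraightLine

variable {V W : Type} [TopologicalSpace V] [NormedAddCommGroup W] [NormedSpace ℝ W]

/-- The barycentric coordinate along the interval of a simplex of `Δ[1]`. -/
noncomputable def intervalCoord {n : SimplexCategoryᵒᵖ} (s : (Δ[1] : SSet.{0}).obj n) :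
    C(stdSimplex ℝ (Fin (n.unop.len + 1)), ℝ) where
  toFun x := stdSimplex.map (SSet.stdSimplex.objEquiv s).toOrderHom x (1 : Fin 2)
  continuous_toFun := (continuous_apply _).comp
    (continuous_subtype_val.comp (stdSimplex.continuous_map _))

lemma intervalCoord_map {m n : SimplexCategoryᵒᵖ} (f : m ⟶ n) (s : (Δ[1] : SSet.{0}).obj m)
    (x : stdSimplex ℝ (Fin (n.unop.len + 1))) :
    intervalCoord ((Δ[1] : SSet.{0}).map f s) x =
      intervalCoord s (stdSimplex.map f.unop.toOrderHom x) := by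
  change stdSimplex.map _ x (1 : Fin 2) = stdSimplex.map _ (stdSimplex.map _ x) (1 : Fin 2)
  rw [stdSimplex.map_comp_apply]
  rfl

lemma intervalCoord_mem {n : SimplexCategoryᵒᵖ} (s : (Δ[1] : SSet.{0}).obj n)
    (x : stdSimplex ℝ (Fin (n.unop.len + 1))) : intervalCoord s x ∈ Set.Icc (0 : ℝ) 1 :=
  ⟨stdSimplex.zero_le (stdSimplex.map (SSet.stdSimplex.objEquiv s).toOrderHom x) (1 : Fin 2),
    stdSimplex.le_one (stdSimplex.map (SSet.stdSimplex.objEquiv s).toOrderHom x) (1 : Fin 2)⟩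

lemma intervalCoord_of_forall_eq_zero {n : SimplexCategoryᵒᵖ} (s : (Δ[1] : SSet.{0}).obj n)
    (h : ∀ j, (SSet.stdSimplex.objEquiv s).toOrderHom j = (0 : Fin 2))
    (x : stdSimplex ℝ (Fin (n.unop.len + 1))) : intervalCoord s x = 0 := by
  change FunOnFinite.linearMap ℝ ℝ _ x (1 : Fin 2) = 0
  rw [FunOnFinite.linearMap_apply_apply]
  exact Finset.sum_eq_zero fun j hj => by simp [h j] at hj

lemma intervalCoord_of_forall_eq_one {n : SimplexCategoryᵒᵖ} (s : (Δ[1] : SSet.{0}).obj n)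
    (h : ∀ j, (SSet.stdSimplex.objEquiv s).toOrderHom j = (1 : Fin 2))
    (x : stdSimplex ℝ (Fin (n.unop.len + 1))) : intervalCoord s x = 1 := by
  change FunOnFinite.linearMap ℝ ℝ _ x (1 : Fin 2) = 1
  rw [FunOnFinite.linearMap_apply_apply, Finset.filter_true_of_mem fun j _ => h j]
  exact stdSimplex.sum_eq_one x

/-- The straight-line homotopy between two operations on singular simplices with values in a
vector space. -/
noncomputable def straightLineMap (f g : singularSet V ⟶ singularSet W) :
    singularSet V ⊗ Δ[1] ⟶ singularSet W where
  app n := TypeCat.ofHom fun p => ofCMap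
    ⟨fun x => (1 - intervalCoord p.2 x) • toCMap (f.app n p.1) x +
      intervalCoord p.2 x • toCMap (g.app n p.1) x, by fun_prop⟩
  naturality m n φ := by
    refine ConcreteCategory.hom_ext _ _ fun p => simplex_ext fun x => ?_
    change (1 - intervalCoord ((Δ[1] : SSet.{0}).map φ p.2) x) •
        toCMap (f.app n ((singularSet V).map φ p.1)) x +
      intervalCoord ((Δ[1] : SSet.{0}).map φ p.2) x •
        toCMap (g.app n ((singularSet V).map φ p.1)) x =
      (1 - intervalCoord p.2 (stdSimplex.map φ.unop.toOrderHom x)) •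
        toCMap (f.app m p.1) (stdSimplex.map φ.unop.toOrderHom x) +
      intervalCoord p.2 (stdSimplex.map φ.unop.toOrderHom x) •
        toCMap (g.app m p.1) (stdSimplex.map φ.unop.toOrderHom x)
    rw [NatTrans.naturality_apply, NatTrans.naturality_apply, toCMap_map_apply, toCMap_map_apply,
      intervalCoord_map]

lemma straightLineMap_apply (f g : singularSet V ⟶ singularSet W) {n : SimplexCategoryᵒᵖ}
    (p : (singularSet V ⊗ Δ[1]).obj n) (x) :
    toCMap ((straightLineMap f g).app n p) x =
      (1 - intervalCoord p.2 x) • toCMap (f.app n p.1) x +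
        intervalCoord p.2 x • toCMap (g.app n p.1) x := rfl

/-- The straight-line homotopy between two operations on singular simplices with values in a
vector space, as a homotopy of maps of simplicial sets. -/
noncomputable def straightLine (f g : singularSet V ⟶ singularSet W) : SSet.Homotopy f g where
  h := straightLineMap f g
  h₀ := by
    refine NatTrans.ext (funext fun n => ConcreteCategory.hom_ext _ _ fun σ =>
      simplex_ext fun x => ?_)
    refine (straightLineMap_apply f g (SSet.ι₀.app n σ) x).trans ?_
    rw [intervalCoord_of_forall_eq_zero _ fun j => rfl]
    simp
  h₁ := by
    refine NatTrans.ext (funext fun n => ConcreteCategory.hom_ext _ _ fun σ =>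
      simplex_ext fun x => ?_)
    refine (straightLineMap_apply f g (SSet.ι₁.app n σ) x).trans ?_
    rw [intervalCoord_of_forall_eq_one _ fun j => rfl]
    simp
  rel := by ext _ ⟨⟨_, ⟨⟩⟩, _⟩

variable (R : Type u) [Ring R]

/-- The chain homotopy given by straight lines. -/
noncomputable def lineOp (f g : singularSet V ⟶ singularSet W) (n : ℕ) :
    ((singularSet V) _⦋n⦌ →₀ R) →ₗ[R] ((singularSet W) _⦋n + 1⦌ →₀ R) :=
  prism R (straightLine f g).toSimplicialObjectHomotopy n

/-- A prism simplex is the homotopy evaluated on a degeneracy of `σ`. By naturality its value at `x`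
lies on the segment over the image of `x` under that degeneracy. -/
lemma straightLine_mem_simplicesIn (f g : singularSet V ⟶ singularSet W) {n : ℕ}
    (σ : (singularSet V) _⦋n⦌) {S : Set W}
    (h : ∀ x, segment ℝ (toCMap (f.app _ σ) x) (toCMap (g.app _ σ) x) ⊆ S) (i : Fin (n + 1)) :
    (straightLine f g).toSimplicialObjectHomotopy.h i σ ∈ simplicesIn S (n + 1) := by
  intro x
  let s : (Δ[1] : SSet.{0}) _⦋n + 1⦌ := SSet.stdSimplex.objMk₁ i.succ.castSucc
  change (1 - intervalCoord s x) • toCMap (f.app _ ((singularSet V).map _ σ)) x +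
    intervalCoord s x • toCMap (g.app _ ((singularSet V).map _ σ)) x ∈ S
  rw [NatTrans.naturality_apply, NatTrans.naturality_apply, toCMap_map_apply, toCMap_map_apply]
  refine h _ ⟨1 - intervalCoord s x, intervalCoord s x, ?_, (intervalCoord_mem s x).1, by ring,
    rfl⟩
  linarith [(intervalCoord_mem s x).2]

/-- The endpoints are operations on simplices, not maps of the space, because `bernsteinOp` is not
induced by a continuous map. The condition on segments is therefore imposed simplex by simplex. -/
lemma lineOp_mem (f g : singularSet V ⟶ singularSet W) {n : ℕ}
    {c : (singularSet V) _⦋n⦌ →₀ R} {S : Set W}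
    (h : ∀ σ ∈ c.support, ∀ x, segment ℝ (toCMap (f.app _ σ) x) (toCMap (g.app _ σ) x) ⊆ S) :
    lineOp R f g n c ∈ chainsIn R S (n + 1) := by
  rw [← c.sum_single, Finsupp.sum, map_sum]
  refine Submodule.sum_mem _ fun σ hσ => ?_
  rw [lineOp, prism_single]
  refine Submodule.neg_mem _ (Submodule.sum_mem _ fun i _ => ?_)
  exact zsmul_mem (Finsupp.single_mem_supported R _
    (straightLine_mem_simplicesIn f g σ (h σ hσ) i)) _

lemma mapDomain_mem_chainsIn {V' : Type} [TopologicalSpace V'] (f : singularSet V ⟶ singularSet V')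
    {n : ℕ} {c : (singularSet V) _⦋n⦌ →₀ R} {S : Set V'}
    (h : ∀ σ ∈ c.support, ∀ x, toCMap (f.app _ σ) x ∈ S) :
    Finsupp.mapDomain (f.app (.op ⦋n⦌)) c ∈ chainsIn R S n := by
  classical
  refine (Finsupp.mem_supported R _).2 fun τ hτ => ?_
  obtain ⟨σ, hσ, rfl⟩ := Finset.mem_image.1 (Finsupp.mapDomain_support hτ)
  exact h σ hσ

lemma boundary_lineOp_zero (f g : singularSet V ⟶ singularSet W) (c : (singularSet V) _⦋0⦌ →₀ R) :
    Finsupp.mapDomain (f.app (.op ⦋0⦌)) c =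
      boundary R _ 0 (lineOp R f g 0 c) + Finsupp.mapDomain (g.app (.op ⦋0⦌)) c :=
  boundary_prism_zero R _ c

lemma boundary_lineOp_succ (f g : singularSet V ⟶ singularSet W) {n : ℕ}
    (c : (singularSet V) _⦋n + 1⦌ →₀ R) :
    Finsupp.mapDomain (f.app (.op ⦋n + 1⦌)) c =
      lineOp R f g n (boundary R _ n c) + boundary R _ (n + 1) (lineOp R f g (n + 1) c) +
        Finsupp.mapDomain (g.app (.op ⦋n + 1⦌)) c :=
  boundary_prism_succ R _ c

/-- On cycles the straight-line homotopy has no correction term. -/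
lemma boundary_lineOp_of_boundary (f g : singularSet V ⟶ singularSet W) {n : ℕ}
    (c : (singularSet V) _⦋n + 1⦌ →₀ R) :
    Finsupp.mapDomain (f.app (.op ⦋n⦌)) (boundary R _ n c) =
      boundary R _ n (lineOp R f g n (boundary R _ n c)) +
        Finsupp.mapDomain (g.app (.op ⦋n⦌)) (boundary R _ n c) := by
  cases n with
  | zero => exact boundary_lineOp_zero R f g _
  | succ n =>
    have := boundary_lineOp_succ R f g (boundary R _ _ c)
    rwa [boundary_boundary, map_zero, zero_add] at this

end StraightLine

/-! ### Coning in star-shaped sets. -/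

section StarShaped

variable {V : Type} [NormedAddCommGroup V] [NormedSpace ℝ V]

/-- The operation on singular simplices induced by a continuous map. -/
noncomputable def postcomp {V W : Type} [TopologicalSpace V] [TopologicalSpace W] (φ : C(V, W)) :
    singularSet V ⟶ singularSet W where
  app n := TypeCat.ofHom fun σ => ofCMap (φ.comp (toCMap σ))
  naturality := by intros; rfl

lemma mapDomain_id_app {R : Type u} [Ring R] {V : Type} [TopologicalSpace V] {n : ℕ}
    (c : (singularSet V) _⦋n⦌ →₀ R) :
    Finsupp.mapDomain ((𝟙 (singularSet V) : singularSet V ⟶ _).app (.op ⦋n⦌)) c = c :=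
  Finsupp.mapDomain_id

variable (R : Type u) [Ring R]

/-- In a star-shaped set, chains that bound in the ambient space bound. -/
lemma exists_boundary_of_starConvex {S : Set V} {q : V} (hS : StarConvex ℝ q S) (hq : q ∈ S)
    {n : ℕ} (c : (singularSet V) _⦋n + 1⦌ →₀ R) (hc : boundary R _ n c ∈ chainsIn R S n) :
    ∃ y ∈ chainsIn R S (n + 1), boundary R _ n y = boundary R _ n c := by
  let κ := postcomp (ContinuousMap.const V q)
  -- The homotopy leaves the constant chain `κ (∂c) = ∂(κ c)`, and `κ c` lies in `S` even when `c`
  -- does not. This also covers degree `0`.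
  refine ⟨lineOp R (𝟙 _) κ n (boundary R _ n c) + Finsupp.mapDomain (κ.app _) c,
    Submodule.add_mem _ (lineOp_mem R _ _ fun σ hσ x => ?_)
      (mapDomain_mem_chainsIn R _ fun σ _ x => hq), ?_⟩
  · rw [segment_symm]
    exact starConvex_iff_segment_subset.1 hS (hc hσ x)
  · rw [map_add, boundary_mapDomain, ← boundary_lineOp_of_boundary, mapDomain_id_app]

/-- The constant simplex. -/
noncomputable def constSimplex {V : Type} [TopologicalSpace V] (q : V) (n : ℕ) : (singularSet V) _⦋n⦌ :=
  ofCMap (ContinuousMap.const _ q)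

lemma mapDomain_const {V : Type} [TopologicalSpace V] (q : V) {n : ℕ} (c : (singularSet V) _⦋n⦌ →₀ R) :
    Finsupp.mapDomain ((postcomp (ContinuousMap.const V q)).app (.op ⦋n⦌)) c =
      Finsupp.single (constSimplex q n) (c.sum fun _ r => r) := by
  rw [Finsupp.mapDomain, Finsupp.single_sum]
  rfl

lemma boundary_single_const {V : Type} [TopologicalSpace V] (q : V) (n : ℕ) (r : R) :
    boundary R _ n (Finsupp.single (constSimplex q (n + 1)) r) =
      if Even n then 0 else Finsupp.single (constSimplex q n) r := by
  rw [boundary_single]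
  have : ∀ i : Fin (n + 2), (singularSet V).δ i (constSimplex q (n + 1)) = constSimplex q n :=
    fun i => rfl
  simp only [this]
  rw [← Finset.sum_smul, Fin.sum_neg_one_pow]
  by_cases h : Even n <;> simp [h, Nat.even_add]

/-- Cycles of positive degree in a star-shaped set are boundaries. -/
lemma exists_boundary_eq_of_starConvex {S : Set V} {q : V} (hS : StarConvex ℝ q S) (hq : q ∈ S)
    {n : ℕ} (z : (singularSet V) _⦋n + 1⦌ →₀ R) (hz : z ∈ chainsIn R S (n + 1))
    (hd : boundary R _ n z = 0) :
    ∃ y ∈ chainsIn R S (n + 2), boundary R _ (n + 1) y = z := by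
  let κ := postcomp (ContinuousMap.const V q)
  have hom := boundary_lineOp_succ R (𝟙 _) κ z
  rw [hd, map_zero, zero_add, mapDomain_id_app, mapDomain_const] at hom
  suffices h : ∃ y ∈ chainsIn R S (n + 2), boundary R _ (n + 1) y =
      Finsupp.single (constSimplex q (n + 1)) (z.sum fun _ r => r) by
    obtain ⟨y, hy, hyz⟩ := h
    refine ⟨lineOp R (𝟙 _) κ (n + 1) z + y, Submodule.add_mem _ (lineOp_mem R _ _
      fun σ hσ x => ?_) hy, ?_⟩
    · rw [segment_symm]
      exact starConvex_iff_segment_subset.1 hS (hz hσ x)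
    · rw [map_add, hyz]
      exact hom.symm
  -- For even `n` the constant simplex of degree `n + 1` is the boundary of the next one. For odd
  -- `n` its boundary is nonzero, so `∂z = 0` forces the coefficients of `z` to sum to `0`.
  rcases Nat.even_or_odd n with hn | hn
  · refine ⟨Finsupp.single (constSimplex q (n + 2)) (z.sum fun _ r => r),
      Finsupp.single_mem_supported R _ fun x => hq, ?_⟩
    rw [boundary_single_const, if_neg (by simpa [Nat.even_add_one] using hn)]
  · refine ⟨0, Submodule.zero_mem _, ?_⟩
    have h0 := boundary_mapDomain R κ z
    rw [hd, Finsupp.mapDomain_zero, mapDomain_const, boundary_single_const,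
      if_neg (by simpa using hn)] at h0
    rw [map_zero, Finsupp.single_eq_zero.1 h0, Finsupp.single_zero]

end StarShaped

end MinMax

namespace MinMax

open Simplicial

/-! ### Bernstein approximation of singular simplices. -/

section Bernstein

variable {X Y : Type} [Fintype X] [Fintype Y] {E : Type} [NormedAddCommGroup E] [NormedSpace ℝ E]

/-- The Bernstein polynomial of degree `N + 1` of a function on the standard simplex. -/
noncomputable def bernsteinPoly (N : ℕ) (σ : stdSimplex ℝ X → E) (v : X → ℝ) : E :=
  ∑ φ : Fin (N + 1) → X, (∏ j, v (φ j)) • σ (stdSimplex.map φ stdSimplex.barycenter)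

lemma contDiff_bernsteinPoly (N : ℕ) (σ : stdSimplex ℝ X → E) :
    ContDiff ℝ 1 (bernsteinPoly N σ) := by
  refine ContDiff.sum fun φ _ => ContDiff.smul (contDiff_prod fun j _ => ?_) contDiff_const
  exact contDiff_apply ℝ ℝ (φ j)

lemma bernsteinPoly_smul (N : ℕ) (σ : stdSimplex ℝ X → E) (c : ℝ) (v : X → ℝ) :
    bernsteinPoly N σ (c • v) = c ^ (N + 1) • bernsteinPoly N σ v := by
  simp [bernsteinPoly, Finset.smul_sum, Finset.prod_mul_distrib, smul_smul]

/-- The polynomial at `t` is the expected value of `σ` at the empirical distribution of `N + 1`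
independent draws from `t`, and pushing draws forward along `ψ` pushes that distribution forward.
This is what makes `bernsteinOp` commute with faces and degeneracies. -/
lemma bernsteinPoly_map (N : ℕ) (ψ : X → Y) (σ : stdSimplex ℝ Y → E) (t : stdSimplex ℝ X) :
    bernsteinPoly N σ (stdSimplex.map ψ t) = bernsteinPoly N (fun x => σ (stdSimplex.map ψ x)) t := by
  classical
  simp only [bernsteinPoly, stdSimplex.map_comp_apply, stdSimplex.map_coe]
  rw [← Finset.sum_fiberwise Finset.univ (fun φ : Fin (N + 1) → X => ψ ∘ φ)]
  refine Finset.sum_congr rfl fun φ _ => ?_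
  have h : ∏ j, FunOnFinite.linearMap ℝ ℝ ψ t (φ j) =
      ∑ χ : Fin (N + 1) → X with ψ ∘ χ = φ, ∏ j, t (χ j) := by
    simp only [FunOnFinite.linearMap_apply_apply]
    rw [Finset.prod_univ_sum]
    refine Finset.sum_congr ?_ fun _ _ => rfl
    ext χ
    simp [funext_iff]
  rw [h, Finset.sum_smul]
  refine Finset.sum_congr rfl fun χ hχ => ?_
  rw [← (Finset.mem_filter.1 hχ).2]

/-- Total mass, mean and variance for a sum of `M` independent copies of a centred variable, by
splitting off one draw. -/
lemma sum_multinomial_moments (t Z : X → ℝ) (ht : ∑ x, t x = 1) (hZ : ∑ x, t x * Z x = 0) (M : ℕ) :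
    ∑ φ : Fin M → X, ∏ j, t (φ j) = 1 ∧
    ∑ φ : Fin M → X, (∏ j, t (φ j)) * ∑ j, Z (φ j) = 0 ∧
    ∑ φ : Fin M → X, (∏ j, t (φ j)) * (∑ j, Z (φ j)) ^ 2 = M * ∑ x, t x * Z x ^ 2 := by
  induction M with
  | zero => simp
  | succ M ih =>
    obtain ⟨h0, h1, h2⟩ := ih
    have key (F : (Fin (M + 1) → X) → ℝ) :
        ∑ φ, F φ = ∑ x, ∑ φ : Fin M → X, F (Fin.cons x φ) := by
      rw [← (Fin.consEquiv fun _ => X).sum_comp, Fintype.sum_prod_type]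
      rfl
    simp only [key, Fin.prod_univ_succ, Fin.sum_univ_succ, Fin.cons_zero, Fin.cons_succ]
    refine ⟨?_, ?_, ?_⟩
    · simp only [← Finset.mul_sum, h0, mul_one, ht]
    · calc _ = ∑ x, (t x * Z x * ∑ φ : Fin M → X, ∏ j, t (φ j) +
            t x * ∑ φ : Fin M → X, (∏ j, t (φ j)) * ∑ j, Z (φ j)) := by
            refine Finset.sum_congr rfl fun x _ => ?_
            rw [Finset.mul_sum, Finset.mul_sum, ← Finset.sum_add_distrib]
            exact Finset.sum_congr rfl fun φ _ => by ring
        _ = 0 := by simp [h0, h1, hZ]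
    · calc _ = ∑ x, (t x * Z x ^ 2 * ∑ φ : Fin M → X, ∏ j, t (φ j) +
            2 * (t x * Z x) * ∑ φ : Fin M → X, (∏ j, t (φ j)) * ∑ j, Z (φ j) +
            t x * ∑ φ : Fin M → X, (∏ j, t (φ j)) * (∑ j, Z (φ j)) ^ 2) := by
            refine Finset.sum_congr rfl fun x _ => ?_
            rw [Finset.mul_sum, Finset.mul_sum, Finset.mul_sum, ← Finset.sum_add_distrib,
              ← Finset.sum_add_distrib]
            exact Finset.sum_congr rfl fun φ _ => by ring
        _ = _ := by
            simp only [h0, h1, h2, mul_one, mul_zero, add_zero, Finset.sum_add_distrib]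
            rw [← Finset.sum_mul, ht]
            push_cast
            ring

lemma sum_prod_eq_one (N : ℕ) (t : stdSimplex ℝ X) :
    ∑ φ : Fin (N + 1) → X, ∏ j, t (φ j) = 1 :=
  (sum_multinomial_moments (⇑t) 0 (stdSimplex.sum_eq_one t) (by simp) (N + 1)).1

lemma variance_le (N : ℕ) (t : stdSimplex ℝ X) (i : X) :
    ∑ φ : Fin (N + 1) → X, (∏ j, t (φ j)) *
      (stdSimplex.map φ (stdSimplex.barycenter (𝕜 := ℝ)) i - t i) ^ 2 ≤ 1 / (N + 1) := by
  classical
  -- The centred indicator of the outcome `i`; its average over the draws is the deviation of the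
  -- empirical frequency.
  let Z : X → ℝ := fun x => (if x = i then 1 else 0) - t i
  have hZ : ∑ x, t x * Z x = 0 := by
    simp [Z, mul_sub, Finset.sum_sub_distrib, ← Finset.sum_mul, stdSimplex.sum_eq_one]
  have hm := (sum_multinomial_moments (⇑t) Z (stdSimplex.sum_eq_one t) hZ (N + 1)).2.2
  have hN : (0 : ℝ) < N + 1 := by positivity
  have hmap (φ : Fin (N + 1) → X) :
      stdSimplex.map φ (stdSimplex.barycenter (𝕜 := ℝ)) i - t i =
        (N + 1 : ℝ)⁻¹ * ∑ j, Z (φ j) := by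
    have : stdSimplex.map φ (stdSimplex.barycenter (𝕜 := ℝ)) i =
        ∑ j, if φ j = i then (N + 1 : ℝ)⁻¹ else 0 := by
      rw [stdSimplex.map_coe, FunOnFinite.linearMap_apply_apply, Finset.sum_filter]
      refine Finset.sum_congr rfl fun j _ => ?_
      change (if φ j = i then (Fintype.card (Fin (N + 1)) : ℝ)⁻¹ else 0) = _
      simp
    rw [this]
    simp only [Z, Finset.sum_sub_distrib, mul_sub, Finset.mul_sum, mul_ite, mul_one, mul_zero]
    simp
    field_simp
  simp only [hmap, mul_pow]
  have hv : ∑ x, t x * Z x ^ 2 ≤ 1 := by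
    rw [← stdSimplex.sum_eq_one t]
    refine Finset.sum_le_sum fun x _ => mul_le_of_le_one_right (stdSimplex.zero_le t x) ?_
    have h0 := stdSimplex.zero_le t i
    have h1 := stdSimplex.le_one t i
    rw [sq_le_one_iff_abs_le_one, abs_le]
    dsimp [Z]
    split_ifs <;> constructor <;> linarith
  calc _ = ((N + 1 : ℝ)⁻¹) ^ 2 * ∑ φ : Fin (N + 1) → X, (∏ j, t (φ j)) * (∑ j, Z (φ j)) ^ 2 := by
        rw [Finset.mul_sum]
        exact Finset.sum_congr rfl fun φ _ => by ring
    _ = (N + 1 : ℝ)⁻¹ * ∑ x, t x * Z x ^ 2 := by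
        rw [hm]
        push_cast
        field_simp
    _ ≤ (N + 1 : ℝ)⁻¹ * 1 := by gcongr
    _ = _ := by simp

/-- Bernstein polynomials approximate continuous functions on the standard simplex uniformly. -/
lemma eventually_bernsteinPoly_close (σ : C(stdSimplex ℝ X, E)) {ε : ℝ} (hε : 0 < ε) :
    ∀ᶠ N in atTop, ∀ t : stdSimplex ℝ X, ‖bernsteinPoly N σ t - σ t‖ ≤ ε := by
  have : CompactSpace (stdSimplex ℝ X) := isCompact_iff_compactSpace.1 (isCompact_stdSimplex ℝ X)
  obtain ⟨δ, hδ, hσ⟩ := Metric.uniformContinuous_iff.1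
    (CompactSpace.uniformContinuous_of_continuous σ.continuous) (ε / 2) (half_pos hε)
  -- Chebyshev's argument: at distance at least `δ` in the sup metric one coordinate gap is at least
  -- `δ`, so `K` times the sum of squares dominates the trivial bound `2 * ‖σ‖`.
  let K : ℝ := 2 * ‖σ‖ / δ ^ 2
  have hK : 0 ≤ K := by positivity
  have pt (a t : stdSimplex ℝ X) : ‖σ a - σ t‖ ≤ ε / 2 + K * ∑ i, (a i - t i) ^ 2 := by
    have hs : 0 ≤ ∑ i, (a i - t i) ^ 2 := Finset.sum_nonneg fun i _ => sq_nonneg _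
    by_cases h : dist a t < δ
    · have := hσ h
      rw [dist_eq_norm] at this
      have := mul_nonneg hK hs
      linarith
    · have hd : δ ^ 2 ≤ ∑ i, (a i - t i) ^ 2 := by
        by_contra! hlt
        refine h ((dist_pi_lt_iff hδ).2 fun i => ?_)
        have : (a i - t i) ^ 2 < δ ^ 2 := (Finset.single_le_sum
          (f := fun i => (a i - t i) ^ 2) (fun i _ => sq_nonneg _) (Finset.mem_univ i)).trans_lt hlt
        rw [Real.dist_eq]
        exact abs_lt_of_sq_lt_sq this hδ.le
      have h2 : ‖σ a - σ t‖ ≤ 2 * ‖σ‖ := by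
        have := norm_sub_le (σ a) (σ t)
        have := σ.norm_coe_le_norm a
        have := σ.norm_coe_le_norm t
        linarith
      have h3 : 2 * ‖σ‖ = K * δ ^ 2 := by
        dsimp [K]
        field_simp
      have := mul_le_mul_of_nonneg_left hd hK
      linarith
  have lim : Tendsto (fun N : ℕ => ε / 2 + K * (Fintype.card X * (1 / ((N : ℝ) + 1)))) atTop
      (nhds (ε / 2 + K * (Fintype.card X * 0))) :=
    ((tendsto_one_div_add_atTop_nhds_zero_nat.const_mul _).const_mul _).const_add _
  filter_upwards [lim.eventually_lt_const (u := ε) (by simp; exact hε)] with N hN t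
  have hw (φ : Fin (N + 1) → X) : 0 ≤ ∏ j, t (φ j) :=
    Finset.prod_nonneg fun j _ => stdSimplex.zero_le t _
  calc ‖bernsteinPoly N σ t - σ t‖
      = ‖∑ φ : Fin (N + 1) → X, (∏ j, t (φ j)) •
          (σ (stdSimplex.map φ stdSimplex.barycenter) - σ t)‖ := by
        simp only [smul_sub, Finset.sum_sub_distrib, ← Finset.sum_smul, sum_prod_eq_one, one_smul]
        rfl
    _ ≤ ∑ φ : Fin (N + 1) → X, (∏ j, t (φ j)) * (ε / 2 + K *
          ∑ i, (stdSimplex.map φ (stdSimplex.barycenter (𝕜 := ℝ)) i - t i) ^ 2) := by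
        refine norm_sum_le_of_le _ fun φ _ => ?_
        rw [norm_smul, Real.norm_of_nonneg (hw φ)]
        exact mul_le_mul_of_nonneg_left (pt _ _) (hw φ)
    _ = ε / 2 + K * ∑ i, ∑ φ : Fin (N + 1) → X, (∏ j, t (φ j)) *
          (stdSimplex.map φ (stdSimplex.barycenter (𝕜 := ℝ)) i - t i) ^ 2 := by
        rw [Finset.sum_comm]
        simp only [mul_add, Finset.sum_add_distrib, ← Finset.sum_mul, sum_prod_eq_one, one_mul]
        congr 1
        rw [Finset.mul_sum]
        refine Finset.sum_congr rfl fun φ _ => ?_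
        rw [← Finset.mul_sum]
        ring
    _ ≤ ε / 2 + K * ∑ _i : X, 1 / ((N : ℝ) + 1) := by
        gcongr with i
        exact variance_le N t i
    _ ≤ ε := by
        rw [Finset.sum_const, nsmul_eq_mul]
        exact hN.le

/-- The operation on singular simplices given by Bernstein polynomials. -/
noncomputable def bernsteinOp (E : Type) [NormedAddCommGroup E] [NormedSpace ℝ E] (N : ℕ) :
    singularSet E ⟶ singularSet E where
  app n := TypeCat.ofHom fun σ => ofCMap ⟨fun t => bernsteinPoly N (toCMap σ) t,
    (contDiff_bernsteinPoly N _).continuous.comp continuous_subtype_val⟩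
  naturality m n f := ConcreteCategory.hom_ext _ _ fun σ => simplex_ext fun x => by
    change bernsteinPoly N (fun y => toCMap σ (stdSimplex.map f.unop.toOrderHom y)) x =
      bernsteinPoly N (toCMap σ) (stdSimplex.map f.unop.toOrderHom x)
    exact (bernsteinPoly_map N _ _ _).symm

/-- Finitely many Bernstein polynomials on simplices of small dimension miss a half line. -/
lemma exists_forall_zero_notMem_segment [FiniteDimensional ℝ E] (N : ℕ)
    (hX : Fintype.card X < Module.finrank ℝ E) (F : Finset C(stdSimplex ℝ X, E)) :
    ∃ q : E, q ≠ 0 ∧ ∀ σ ∈ F, ∀ t : stdSimplex ℝ X, bernsteinPoly N σ t ≠ 0 →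
      (0 : E) ∉ segment ℝ (bernsteinPoly N σ t) q := by
  -- The polynomials are taken on all of `X → ℝ`; these `C¹` images still have Hausdorff dimension
  -- at most `Fintype.card X`, and by homogeneity they contain every nonnegative multiple of their
  -- points. Adding `0` ensures `q ≠ 0`.
  let s : Set E := {0} ∪ ⋃ σ ∈ (F : Set C(stdSimplex ℝ X, E)), Set.range fun v => -bernsteinPoly N σ v
  have hs : dimH s < Module.finrank ℝ E := by
    refine lt_of_le_of_lt (b := ((Fintype.card X : ℕ) : ENNReal)) ?_ (Nat.cast_lt.2 hX)
    rw [dimH_union, dimH_singleton, dimH_bUnion F.countable_toSet]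
    refine max_le bot_le (iSup₂_le fun σ _ => ?_)
    refine ((contDiff_bernsteinPoly N σ).neg.dimH_range_le).trans ?_
    simp
  obtain ⟨q, hq⟩ := (dense_compl_of_dimH_lt_finrank hs).nonempty
  simp only [s, Set.mem_compl_iff, Set.mem_union, Set.mem_singleton_iff, not_or, Set.mem_iUnion,
    not_exists, Set.mem_range] at hq
  refine ⟨q, hq.1, fun σ hσ t ht => ?_⟩
  rintro ⟨a, b, ha, hb, hab, h⟩
  rcases hb.eq_or_lt with rfl | hb
  · simp only [add_zero] at hab
    simp [hab] at h
    exact ht h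
  -- If `a • B(t) + b • q = 0`, then `q = -(a / b) • B(t)`. Homogeneity of degree `N + 1` absorbs
  -- the factor `a / b` into the argument as its `(N + 1)`-st root.
  · refine hq.2 σ hσ (((a / b) ^ ((N + 1 : ℝ)⁻¹)) • (t : X → ℝ)) ?_
    have hpow : ((a / b) ^ ((N + 1 : ℝ)⁻¹)) ^ (N + 1) = a / b := by
      rw [← Real.rpow_natCast, ← Real.rpow_mul (by positivity)]
      push_cast
      rw [inv_mul_cancel₀ (by positivity), Real.rpow_one]
    rw [bernsteinPoly_smul, hpow, ← smul_right_injective E hb.ne' |>.eq_iff]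
    simp only [smul_neg, smul_smul, mul_div_cancel₀ _ hb.ne']
    rw [neg_eq_iff_add_eq_zero]
    exact h

end Bernstein

end MinMax

namespace MinMax

open Simplicial

/-! ### Vanishing of relative homology below the critical degree. -/

section Vanishing

variable {V E : Type} [NormedAddCommGroup V] [NormedSpace ℝ V] [NormedAddCommGroup E]
  [NormedSpace ℝ E]

/-- A set `A` which, through the projection `L : V → E` with section `s`, looks like the exterior
of a ball in `E`: moving the `E`-component outwards while shrinking the complementary component
does not leave `A`. -/
structure IsExteriorLike (L : V →L[ℝ] E) (s : E →L[ℝ] V) (A : Set V) : Prop where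
  exists_le_norm : ∃ ρ > 0, ∀ v ∈ A, ρ ≤ ‖L v‖
  mem_of_norm_le : ∀ v ∈ A, ∀ t ∈ Set.Icc (0 : ℝ) 1, ∀ e : E,
    ‖L v‖ ≤ ‖(1 - t) • L v + t • e‖ → (1 - t) • v + t • s e ∈ A
  exists_mem_of_le_norm : ∃ r, ∀ e : E, r ≤ ‖e‖ → s e ∈ A

/-- The vector is `(1 - t + t * M) • x` plus an error of norm at most `t * M * ρ / 2`. For `M ≥ 2`
the gain `t * (M - 1) * ‖x‖` outweighs it. This keeps the homotopy to the approximation inside `A`.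
-/
lemma norm_le_norm_of_close {x y : E} {ρ t M : ℝ} (hx : ρ ≤ ‖x‖) (hρ : 0 < ρ)
    (hy : ‖y - x‖ ≤ ρ / 2) (ht : t ∈ Set.Icc (0 : ℝ) 1) (hM : 2 ≤ M) :
    ‖x‖ ≤ ‖(1 - t) • x + t • M • y‖ := by
  have h1 : ((1 - t) + t * M) • x = ((1 - t) • x + t • M • y) - (t * M) • (y - x) := by
    module
  have h2 : ‖((1 - t) + t * M) • x‖ = ((1 - t) + t * M) * ‖x‖ := by
    rw [norm_smul, Real.norm_of_nonneg]
    nlinarith [ht.1, ht.2]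
  have h3 : ‖(t * M) • (y - x)‖ ≤ t * M * (ρ / 2) := by
    rw [norm_smul, Real.norm_of_nonneg (by nlinarith [ht.1])]
    exact mul_le_mul_of_nonneg_left hy (by nlinarith [ht.1])
  have h4 := norm_sub_le ((1 - t) • x + t • M • y) ((t * M) • (y - x))
  rw [← h1, h2] at h4
  have h5 : 0 ≤ t * ((M - 1) * ‖x‖ - M * (ρ / 2)) := mul_nonneg ht.1 (by nlinarith)
  nlinarith

lemma exists_pos_forall_le_norm {E : Type} [NormedAddCommGroup E] {n : ℕ} (F : Finset ((singularSet E) _⦋n⦌))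
    (h : ∀ τ ∈ F, ∀ x, toCMap τ x ≠ 0) : ∃ m > 0, ∀ τ ∈ F, ∀ x, m ≤ ‖toCMap τ x‖ := by
  have hF : ∀ᶠ m in nhdsWithin (0 : ℝ) (Set.Ioi 0), ∀ τ ∈ F, ∀ x, m ≤ ‖toCMap τ x‖ := by
    refine (Finset.eventually_all F).2 fun τ hτ => ?_
    have : CompactSpace (stdSimplex ℝ (Fin (n + 1))) :=
      isCompact_iff_compactSpace.1 (isCompact_stdSimplex ℝ _)
    obtain ⟨x₀, -, hx₀⟩ := isCompact_univ.exists_isMinOn (Set.univ_nonempty)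
      (f := fun x : stdSimplex ℝ (Fin (n + 1)) => ‖toCMap τ x‖)
      (toCMap τ).continuous.norm.continuousOn
    filter_upwards [Ioo_mem_nhdsGT (norm_pos_iff.2 (h τ hτ x₀))] with m hm x
    exact hm.2.le.trans (hx₀ (Set.mem_univ x))
  obtain ⟨m, hm, hm'⟩ := (hF.and self_mem_nhdsWithin).exists
  exact ⟨m, hm', hm⟩

lemma starConvex_setOf_notMem_segment (q : E) :
    StarConvex ℝ q {x | (0 : E) ∉ segment ℝ x q} := by
  refine starConvex_iff_segment_subset.2 fun x hx y hy h => hx ?_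
  rw [segment_symm] at hy
  exact (convex_segment x q).segment_subset hy (right_mem_segment ℝ x q) h

variable (R : Type u) [Ring R]

/-- Low-dimensional boundaries in an exterior-like set bound inside the set. -/
theorem IsExteriorLike.exists_boundary_eq [FiniteDimensional ℝ E] {L : V →L[ℝ] E}
    {s : E →L[ℝ] V} {A : Set V} (hA : IsExteriorLike L s A) {k : ℕ}
    (hk : k + 1 < Module.finrank ℝ E) (c : (singularSet V) _⦋k + 1⦌ →₀ R)
    (hc : boundary R _ k c ∈ chainsIn R A k) :
    ∃ y ∈ chainsIn R A (k + 1), boundary R _ k y = boundary R _ k c := by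
  classical
  obtain ⟨ρ, hρ, hAρ⟩ := hA.exists_le_norm
  obtain ⟨r, hr⟩ := hA.exists_mem_of_le_norm
  set a := boundary R _ k c with ha
  have hclose : ∀ᶠ N in atTop, ∀ σ ∈ a.support, ∀ x : stdSimplex ℝ (Fin (k + 1)),
      ‖bernsteinPoly N ((L : C(V, E)).comp (toCMap σ)) x - L (toCMap σ x)‖ ≤ ρ / 2 :=
    (Finset.eventually_all _).2 fun σ _ =>
      eventually_bernsteinPoly_close ((L : C(V, E)).comp (toCMap σ)) (half_pos hρ)
  obtain ⟨N, hN⟩ := hclose.exists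
  let D : singularSet V ⟶ singularSet E := postcomp (L : C(V, E)) ≫ bernsteinOp E N
  have hD (σ : (singularSet V) _⦋k⦌) (x) : toCMap (D.app _ σ) x =
      bernsteinPoly N ((L : C(V, E)).comp (toCMap σ)) x := rfl
  have hD0 (σ) (hσ : σ ∈ a.support) (x : stdSimplex ℝ (Fin (k + 1))) :
      bernsteinPoly N ((L : C(V, E)).comp (toCMap σ)) x ≠ 0 := by
    intro h0
    have h1 := hN σ hσ x
    rw [h0, zero_sub, norm_neg] at h1
    linarith [hAρ _ (hc hσ x)]
  obtain ⟨q, hq, hqs⟩ := exists_forall_zero_notMem_segment (X := Fin (k + 1)) N (by simpa using hk)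
    (a.support.image fun σ => (L : C(V, E)).comp (toCMap σ))
  let U : Set E := {x | (0 : E) ∉ segment ℝ x q}
  have hqU : q ∈ U := by
    simp only [U, Set.mem_ofPred_eq, segment_same, Set.mem_singleton_iff]
    exact hq.symm
  have hDU : Finsupp.mapDomain (D.app (.op ⦋k⦌)) a ∈ chainsIn R U k :=
    mapDomain_mem_chainsIn R D fun σ hσ x =>
      hqs _ (Finset.mem_image_of_mem _ hσ) x (hD0 σ hσ x)
  -- The image of `a` is the boundary of the image of `c`, as coning requires; `c` itself need not
  -- lie in `A`.
  rw [ha, ← boundary_mapDomain] at hDU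
  obtain ⟨e, heU, he⟩ := exists_boundary_of_starConvex R (starConvex_setOf_notMem_segment q) hqU
    _ hDU
  rw [boundary_mapDomain, ← ha] at he
  obtain ⟨m, hm, hme⟩ := exists_pos_forall_le_norm e.support fun τ hτ x h0 => heU hτ x (by
    rw [h0]
    exact left_mem_segment ℝ 0 q)
  -- `2` serves the homotopy estimate; `r / m` pushes the filling `e`, which stays at distance `m`
  -- from `0`, beyond radius `r`.
  let M : ℝ := max 2 (r / m)
  let S := postcomp ((M • s : E →L[ℝ] V) : C(E, V))
  have hline := boundary_lineOp_of_boundary R (𝟙 _) (D ≫ S) c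
  rw [← ha, mapDomain_id_app] at hline
  have hcomp : Finsupp.mapDomain ((D ≫ S).app (.op ⦋k⦌)) a =
      Finsupp.mapDomain (S.app (.op ⦋k⦌)) (Finsupp.mapDomain (D.app (.op ⦋k⦌)) a) := by
    rw [← Finsupp.mapDomain_comp]
    rfl
  refine ⟨lineOp R (𝟙 _) (D ≫ S) k a + Finsupp.mapDomain (S.app _) e,
    Submodule.add_mem _ (lineOp_mem R _ _ fun σ hσ x => ?_)
      (mapDomain_mem_chainsIn R S fun τ hτ x => ?_), ?_⟩
  · rintro _ ⟨α, t, hα, ht, hαt, rfl⟩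
    obtain rfl : α = 1 - t := by linarith
    have ht' : t ∈ Set.Icc (0 : ℝ) 1 := ⟨ht, by linarith⟩
    have := hA.mem_of_norm_le _ (hc hσ x) t ht' _
      (norm_le_norm_of_close (hAρ _ (hc hσ x)) hρ (hN σ hσ x) ht' (le_max_left 2 (r / m)))
    rw [map_smul] at this
    exact this
  · change M • s (toCMap τ x) ∈ A
    rw [← map_smul]
    refine hr _ ?_
    rw [norm_smul, Real.norm_of_nonneg (le_trans zero_le_two (le_max_left _ _))]
    calc r = r / m * m := by field_simp
      _ ≤ M * ‖toCMap τ x‖ := mul_le_mul (le_max_right _ _) (hme τ hτ x) hm.le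
          (le_trans zero_le_two (le_max_left _ _))
  · rw [map_add, boundary_mapDomain, he, ← hcomp]
    exact hline.symm

/-- The relative homology of a star-shaped set modulo an exterior-like subset vanishes
just below the critical dimension. -/
theorem IsExteriorLike.exists_sub_boundary_mem [FiniteDimensional ℝ E] {L : V →L[ℝ] E}
    {s : E →L[ℝ] V} {A B : Set V} (hA : IsExteriorLike L s A) (hAB : A ⊆ B)
    (hB : StarConvex ℝ 0 B) {k : ℕ} (hk : k + 1 = Module.finrank ℝ E)
    (d : (singularSet V) _⦋k⦌ →₀ R) (hd : d ∈ chainsIn R B k) (hdA : IsRelCycle R A k d) :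
    ∃ y ∈ chainsIn R B (k + 1), d - boundary R _ k y ∈ chainsIn R A k := by
  obtain ⟨r, hr⟩ := hA.exists_mem_of_le_norm
  have : Nontrivial E := Module.nontrivial_of_finrank_pos (R := ℝ) (by lia)
  obtain ⟨e, he⟩ := NormedSpace.exists_lt_norm ℝ E r
  have hq : s e ∈ A := hr e he.le
  have h0 : (0 : V) ∈ B := hB.mem ⟨_, hAB hq⟩
  cases k with
  | zero =>
    -- Here `E` is a line and points only have to be moved into `A`. The path goes through `0`,
    -- since `B` is star-shaped about `0` only.
    let κ (v : V) := postcomp (ContinuousMap.const V v)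
    have h1 := boundary_lineOp_zero R (𝟙 _) (κ 0) d
    have h2 := boundary_lineOp_zero R (κ 0) (κ (s e)) d
    rw [mapDomain_id_app] at h1
    refine ⟨lineOp R (𝟙 _) (κ 0) 0 d + lineOp R (κ 0) (κ (s e)) 0 d,
      Submodule.add_mem _ (lineOp_mem R _ _ fun σ hσ x => ?_)
        (lineOp_mem R _ _ fun σ hσ x => ?_), ?_⟩
    · rw [segment_symm]
      exact starConvex_iff_segment_subset.1 hB (hd hσ x)
    · exact starConvex_iff_segment_subset.1 hB (hAB hq)
    · have : d - boundary R _ 0 (lineOp R (𝟙 _) (κ 0) 0 d + lineOp R (κ 0) (κ (s e)) 0 d) =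
          Finsupp.mapDomain ((κ (s e)).app (.op ⦋0⦌)) d := by
        rw [map_add]
        nth_rewrite 1 [h1]
        rw [h2]
        abel
      rw [this]
      exact mapDomain_mem_chainsIn R _ fun _ _ _ => hq
  | succ j =>
    -- Replacing `d` by `d - a`, with `a` in `A` of the same boundary, gives an absolute cycle of
    -- positive degree in `B`.
    obtain ⟨a, ha, had⟩ := hA.exists_boundary_eq R (by lia) d hdA
    obtain ⟨y, hy, hyd⟩ := exists_boundary_eq_of_starConvex R hB h0 (d - a)
      (Submodule.sub_mem _ hd (fun σ hσ x => hAB (ha hσ x)))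
      (by rw [map_sub, had, sub_self])
    exact ⟨y, hy, by rwa [hyd, sub_sub_cancel]⟩

end Vanishing

end MinMax

namespace MinMax

open Simplicial

/-! ### Universal coefficients on chains. -/

section Coefficients

/-- A finite family in an abelian group is an integral combination of a family `g` all of whose
relations are generated by relations `a j • g j = 0`. -/
lemma exists_diagonal_generators {J : Type*} [Fintype J] {G : Type*} [AddCommGroup G]
    (x : J → G) : ∃ (g : J → G) (a : J → ℤ) (m : J → J → ℤ), (∀ j, a j • g j = 0) ∧
      (∀ k : J → ℤ, ∑ j, k j • g j = 0 → ∀ j, a j ∣ k j) ∧ ∀ i, x i = ∑ j, m i j • g j := by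
  classical
  let π : (J →₀ ℤ) →ₗ[ℤ] G := Finsupp.linearCombination ℤ x
  obtain ⟨n, S⟩ := Submodule.smithNormalForm
    (Finsupp.basisSingleOne (R := ℤ) (ι := J)) (LinearMap.ker π)
  -- Basis vectors outside `S.f` carry no relation; their default `a j = 0` expresses this, since `0
  -- ∣ k j` means `k j = 0`.
  refine ⟨fun j => π (S.bM j), Function.extend S.f S.a 0,
    fun i => S.bM.equivFun (Finsupp.single i 1), fun j => ?_, fun k hk j => ?_, fun i => ?_⟩
  · by_cases hj : j ∈ Set.range S.f
    · obtain ⟨i, rfl⟩ := hj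
      rw [S.f.injective.extend_apply, ← map_smul, ← S.snf]
      exact (S.bN i).2
    · rw [Function.extend_apply' _ _ _ hj, Pi.zero_apply, zero_smul]
  · have hmem : S.bM.equivFun.symm k ∈ LinearMap.ker π := by
      rw [LinearMap.mem_ker, Module.Basis.equivFun_symm_apply, map_sum]
      simpa only [map_smul] using hk
    have hrepr : S.bM.repr (S.bM.equivFun.symm k) j = k j := by
      rw [← Module.Basis.equivFun_apply, LinearEquiv.apply_symm_apply]
    rw [← hrepr]
    by_cases hj : j ∈ Set.range S.f
    · obtain ⟨i, rfl⟩ := hj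
      rw [S.f.injective.extend_apply]
      have h := S.repr_apply_embedding_eq_repr_smul (m := ⟨_, hmem⟩) (i := i)
      rw [map_smul] at h
      exact ⟨_, h⟩
    · exact (S.repr_eq_zero_of_notMem_range ⟨_, hmem⟩ hj).symm ▸ dvd_zero _
  · simp only [← map_smul, ← map_sum, Module.Basis.sum_equivFun]
    simp [π]

variable {R : Type u} [Ring R]

/-- Change of coefficients of integral chains along `n ↦ n • g`. -/
noncomputable def coeffMap {S : Type*} (g : R) : (S →₀ ℤ) →+ (S →₀ R) :=
  Finsupp.mapRange.addMonoidHom (zmultiplesHom R g)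

lemma coeffMap_apply {S : Type*} (g : R) (c : S →₀ ℤ) (s : S) : coeffMap g c s = c s • g := rfl

lemma coeffMap_single {S : Type*} (g : R) (s : S) (n : ℤ) :
    coeffMap g (Finsupp.single s n) = Finsupp.single s (n • g) := by
  classical
  ext t
  by_cases h : s = t <;> simp [coeffMap_apply, h]

lemma coeffMap_boundary {X : SSet.{0}} {n : ℕ} (g : R) (c : X _⦋n + 1⦌ →₀ ℤ) :
    coeffMap g (boundary ℤ X n c) = boundary R X n (coeffMap g c) := by
  induction c using Finsupp.induction_linear with
  | zero => simp
  | add c d hc hd => simp only [map_add, hc, hd]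
  | single x r =>
    simp only [coeffMap_single, boundary_single, map_sum, map_zsmul]

lemma coeffMap_smul_eq_zero {S : Type*} {g : R} {a : ℤ} (h : a • g = 0) (c : S →₀ ℤ) :
    coeffMap g (a • c) = 0 := by
  ext s
  rw [coeffMap_apply, Finsupp.smul_apply, smul_eq_mul, mul_comm, mul_smul, h, smul_zero,
    Finsupp.zero_apply]

/-- A chain is a combination of integral chains with coefficients whose only relations come from
torsion. -/
lemma exists_coeffMap_decomposition {S : Type} (c : S →₀ R) :
    ∃ (J : Type) (_ : Fintype J) (g : J → R) (a : J → ℤ) (ĉ : J → (S →₀ ℤ)),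
      (∀ j, a j • g j = 0) ∧ (∀ k : J → ℤ, ∑ j, k j • g j = 0 → ∀ j, a j ∣ k j) ∧
      (∀ j s, c s = 0 → ĉ j s = 0) ∧ c = ∑ j, coeffMap (g j) (ĉ j) := by
  classical
  obtain ⟨g, a, m, ha, hk, hm⟩ := exists_diagonal_generators fun i : c.support => c i
  refine ⟨c.support, inferInstance, g, a, fun j => Finsupp.onFinset c.support
    (fun s => if h : s ∈ c.support then m ⟨s, h⟩ j else 0) fun s hs => ?_, ha, hk,
    fun j s hs => ?_, ?_⟩
  · by_contra h
    simp [h] at hs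
  · simp [hs]
  · ext s
    rw [Finsupp.finsetSum_apply]
    simp only [coeffMap_apply, Finsupp.onFinset_apply]
    by_cases h : s ∈ c.support
    · simp only [dif_pos h]
      exact hm ⟨s, h⟩
    · simp only [dif_neg h, zero_smul, Finset.sum_const_zero]
      exact Finsupp.notMem_support_iff.1 h

variable {V : Type} [TopologicalSpace V] {A B B' : Set V}

lemma mem_chainsIn_iff_apply {n : ℕ} {c : (singularSet V) _⦋n⦌ →₀ R} :
    c ∈ chainsIn R B n ↔ ∀ σ ∉ simplicesIn B n, c σ = 0 := by
  rw [chainsIn, Finsupp.mem_supported']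

lemma coeffMap_mem_chainsIn {n : ℕ} (g : R) {c : (singularSet V) _⦋n⦌ →₀ ℤ}
    (hc : c ∈ chainsIn ℤ B n) : coeffMap g c ∈ chainsIn R B n := by
  refine mem_chainsIn_iff_apply.2 fun σ hσ => ?_
  rw [coeffMap_apply, mem_chainsIn_iff_apply.1 hc σ hσ, zero_smul]

lemma boundary_mem_chainsIn {n : ℕ} {c : (singularSet V) _⦋n + 1⦌ →₀ R}
    (hc : c ∈ chainsIn R B (n + 1)) : boundary R _ n c ∈ chainsIn R B n := by
  rw [← c.sum_single, Finsupp.sum, map_sum]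
  refine Submodule.sum_mem _ fun σ hσ => ?_
  rw [boundary_single]
  refine Submodule.sum_mem _ fun i _ => zsmul_mem (Finsupp.single_mem_supported R _ ?_) _
  exact fun x => hc hσ _

lemma IsRelCycle.coeffMap {n : ℕ} (g : R) {c : (singularSet V) _⦋n⦌ →₀ ℤ}
    (hc : IsRelCycle ℤ A n c) : IsRelCycle R A n (coeffMap g c) := by
  cases n with
  | zero => trivial
  | succ n =>
    change boundary R _ n _ ∈ _
    rw [← coeffMap_boundary]
    exact coeffMap_mem_chainsIn g hc

lemma isRelCycle_add {n : ℕ} {c d : (singularSet V) _⦋n⦌ →₀ R} (hc : IsRelCycle R A n c)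
    (hd : IsRelCycle R A n d) : IsRelCycle R A n (c + d) := by
  cases n with
  | zero => trivial
  | succ n =>
    change boundary R _ n _ ∈ _
    rw [map_add]
    exact add_mem hc hd

lemma isRelCycle_zero {n : ℕ} : IsRelCycle R A n (0 : (singularSet V) _⦋n⦌ →₀ R) := by
  cases n with
  | zero => trivial
  | succ n =>
    change boundary R _ n _ ∈ _
    rw [map_zero]
    exact zero_mem _

/-- A combination of integral relative cycles of `(B', A)` is homologous to a relative cycle of
`(B, A)` if this is true of integral relative cycles. -/
lemma RelSurjective.exists_of_sum {n : ℕ} (h : RelSurjective ℤ A B B' n) {J : Type*} (t : Finset J)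
    (g : J → R) (z : J → ((singularSet V) _⦋n⦌ →₀ ℤ)) (hz : ∀ j ∈ t, z j ∈ chainsIn ℤ B' n)
    (hz' : ∀ j ∈ t, IsRelCycle ℤ A n (z j)) :
    ∃ w ∈ chainsIn R B n, IsRelCycle R A n w ∧ ∃ y ∈ chainsIn R B' (n + 1),
      (∑ j ∈ t, coeffMap (g j) (z j)) - w - boundary R _ n y ∈ chainsIn R A n := by
  refine Finset.sum_induction (fun j => coeffMap (g j) (z j)) (fun c => ∃ w ∈ chainsIn R B n,
    IsRelCycle R A n w ∧ ∃ y ∈ chainsIn R B' (n + 1), c - w - boundary R _ n y ∈ chainsIn R A n)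
    ?_ ?_ ?_
  · rintro c d ⟨w, hw, hw', y, hy, hc⟩ ⟨w₁, hw₁, hw₁', y₁, hy₁, hd⟩
    refine ⟨w + w₁, add_mem hw hw₁, isRelCycle_add hw' hw₁', y + y₁, add_mem hy hy₁, ?_⟩
    convert add_mem hc hd using 1
    rw [map_add]
    abel
  · exact ⟨0, zero_mem _, isRelCycle_zero, 0, zero_mem _, by simp⟩
  · intro j hj
    obtain ⟨w, hw, hw', y, hy, hc⟩ := h (z j) (hz j hj) (hz' j hj)
    refine ⟨coeffMap (g j) w, coeffMap_mem_chainsIn _ hw, hw'.coeffMap _, coeffMap (g j) y,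
      coeffMap_mem_chainsIn _ hy, ?_⟩
    rw [← coeffMap_boundary, ← map_sub, ← map_sub]
    exact coeffMap_mem_chainsIn _ hc

/-- In degree `0` every single point is an integral relative cycle, so there is no Tor term to
remove. -/
lemma RelSurjective.of_int_zero (h : RelSurjective ℤ A B B' 0) : RelSurjective R A B B' 0 := by
  intro z hz _
  have := h.exists_of_sum z.support (fun σ => z σ) (fun σ => Finsupp.single σ 1)
    (fun σ hσ => Finsupp.single_mem_supported ℤ _ (hz hσ)) fun _ _ => trivial
  simpa only [coeffMap_single, one_smul, show (∑ σ ∈ z.support, Finsupp.single σ (z σ)) = z from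
    z.sum_single] using this

/-- The universal coefficient argument for one integral chain: if its boundary is divisible by `a`
outside `A` and the integral homology of `(B', A)` vanishes in the degree below, then it can be
made a relative cycle by subtracting a multiple of `a`. -/
lemma exists_sub_smul_isRelCycle {k : ℕ}
    (hv : ∀ d ∈ chainsIn ℤ B' k, IsRelCycle ℤ A k d →
      ∃ y ∈ chainsIn ℤ B' (k + 1), d - boundary ℤ _ k y ∈ chainsIn ℤ A k)
    {c : (singularSet V) _⦋k + 1⦌ →₀ ℤ} (hc : c ∈ chainsIn ℤ B' (k + 1)) (a : ℤ)
    (ha : ∀ τ ∉ simplicesIn A k, a ∣ boundary ℤ _ k c τ) :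
    ∃ e ∈ chainsIn ℤ B' (k + 1), IsRelCycle ℤ A (k + 1) (c - a • e) := by
  classical
  by_cases ha0 : a = 0
  · refine ⟨0, zero_mem _, ?_⟩
    rw [smul_zero, sub_zero]
    exact mem_chainsIn_iff_apply.2 fun τ hτ => by simpa [ha0] using ha τ hτ
  -- The part of `∂c` outside `A`, divided by `a`. Modulo `A`, `a • ∂d` agrees with `∂∂c = 0`, and
  -- `a ≠ 0` can be cancelled coefficientwise, so `d` is a relative cycle.
  let d : (singularSet V) _⦋k⦌ →₀ ℤ :=
    ((boundary ℤ _ k c).filter fun τ => τ ∉ simplicesIn A k).mapRange (· / a) (Int.zero_ediv a)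
  have hd1 : boundary ℤ _ k c - a • d ∈ chainsIn ℤ A k := by
    refine mem_chainsIn_iff_apply.2 fun τ hτ => ?_
    simp [d, hτ, Int.mul_ediv_cancel' (ha τ hτ)]
  have hd2 : d ∈ chainsIn ℤ B' k := by
    refine mem_chainsIn_iff_apply.2 fun τ hτ => ?_
    by_cases h : τ ∈ simplicesIn A k
    · simp [d, h]
    · simp [d, h, mem_chainsIn_iff_apply.1 (boundary_mem_chainsIn hc) τ hτ]
  have hd3 : IsRelCycle ℤ A k d := by
    cases k with
    | zero => trivial
    | succ k =>
      have h := boundary_mem_chainsIn hd1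
      rw [map_sub, boundary_boundary, zero_sub, neg_mem_iff, map_smul] at h
      refine mem_chainsIn_iff_apply.2 fun τ hτ => ?_
      simpa [ha0] using mem_chainsIn_iff_apply.1 h τ hτ
  obtain ⟨e, he, hde⟩ := hv d hd2 hd3
  refine ⟨e, he, ?_⟩
  change boundary ℤ _ k _ ∈ _
  have : boundary ℤ _ k (c - a • e) =
      (boundary ℤ _ k c - a • d) + a • (d - boundary ℤ _ k e) := by
    rw [map_sub, map_smul, smul_sub]
    abel
  rw [this]
  exact add_mem hd1 (Submodule.smul_mem _ _ hde)

/-- The hypothesis `hv` is the vanishing of integral homology one degree lower, which makes every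
`R`-cycle a combination of integral relative cycles. -/
theorem RelSurjective.of_int_succ {k : ℕ} (h : RelSurjective ℤ A B B' (k + 1))
    (hv : ∀ d ∈ chainsIn ℤ B' k, IsRelCycle ℤ A k d →
      ∃ y ∈ chainsIn ℤ B' (k + 1), d - boundary ℤ _ k y ∈ chainsIn ℤ A k) :
    RelSurjective R A B B' (k + 1) := by
  intro z hz hzc
  obtain ⟨J, _, g, a, c, hag, hdvd, hcz, rfl⟩ := exists_coeffMap_decomposition z
  have hc : ∀ j, c j ∈ chainsIn ℤ B' (k + 1) := fun j =>
    mem_chainsIn_iff_apply.2 fun σ hσ => hcz j σ (mem_chainsIn_iff_apply.1 hz σ hσ)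
  have ha : ∀ j, ∀ τ ∉ simplicesIn A k, a j ∣ boundary ℤ _ k (c j) τ := by
    intro j τ hτ
    -- The coefficient of `∂z` at `τ` is `∑ j, (∂c_j)(τ) • g j`; it vanishes off `A`, giving a
    -- relation among the `g j`.
    refine hdvd (fun j => boundary ℤ _ k (c j) τ) ?_ j
    have := mem_chainsIn_iff_apply.1 hzc τ hτ
    rw [map_sum, Finsupp.finsetSum_apply] at this
    simpa only [← coeffMap_boundary, coeffMap_apply] using this
  choose e he hec using fun j => exists_sub_smul_isRelCycle hv (hc j) (a j) (ha j)
  have := h.exists_of_sum Finset.univ g (fun j => c j - a j • e j)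
    (fun j _ => sub_mem (hc j) (Submodule.smul_mem _ _ (he j))) fun j _ => hec j
  simpa only [map_sub, coeffMap_smul_eq_zero (hag _), sub_zero] using this

end Coefficients

end MinMax

namespace MinMax

/-! ### Sublevel sets of a quadratic form. -/

section Quadratic

variable {V : Type} [NormedAddCommGroup V] [NormedSpace ℝ V]

/-- A splitting of a quadratic form `Q` into minus the square of the norm of a projection onto a
negative definite subspace, and a nonnegative form on the complement. -/
structure IsNegativeSplitting {E : Type} [NormedAddCommGroup E] [NormedSpace ℝ E]
    (Q : QuadraticForm ℝ V) (L : V →L[ℝ] E) (s : E →L[ℝ] V) : Prop where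
  apply_section : ∀ e, L (s e) = e
  nonneg : ∀ v, 0 ≤ Q v + ‖L v‖ ^ 2
  map_add_section : ∀ v e, Q (v + s e) + ‖L (v + s e)‖ ^ 2 = Q v + ‖L v‖ ^ 2

/-- Diagonalise `Q`: `L` reads off the coordinates of negative weight `w`, rescaled by `√(-w)`, and
`s` inverts it on their span. Then `Q v + ‖L v‖ ^ 2` is the part of `Q` with nonnegative weights,
which `s` does not touch. -/
theorem exists_isNegativeSplitting [FiniteDimensional ℝ V] (Q : QuadraticForm ℝ V) :
    ∃ (L : V →L[ℝ] EuclideanSpace ℝ (Fin (sigNeg Q)))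
      (s : EuclideanSpace ℝ (Fin (sigNeg Q)) →L[ℝ] V), IsNegativeSplitting Q L s := by
  classical
  obtain ⟨w, ⟨φ⟩⟩ := QuadraticForm.equivalent_weightedSumSquares Q
  have hcard : Nat.card {i | w i < 0} = sigNeg Q :=
    (QuadraticForm.sigNeg_of_equiv_weightedSumSquares ⟨φ⟩).symm
  let κ : Fin (sigNeg Q) ≃ {i | w i < 0} := (Fintype.equivFinOfCardEq
    (by rw [← hcard, Nat.card_eq_fintype_card])).symm
  have hκ : ∀ i, 0 < √(-w (κ i)) := fun i => Real.sqrt_pos.2 (neg_pos.2 (κ i).2)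
  let L₀ : V →ₗ[ℝ] (Fin (sigNeg Q) → ℝ) := LinearMap.pi fun i =>
    √(-w (κ i)) • LinearMap.proj (κ i : Fin _) ∘ₗ φ.toLinearEquiv.toLinearMap
  let s₀ : (Fin (sigNeg Q) → ℝ) →ₗ[ℝ] V := φ.toLinearEquiv.symm.toLinearMap ∘ₗ
    ∑ i, LinearMap.single ℝ (fun _ => ℝ) (κ i : Fin _) ∘ₗ
      ((√(-w (κ i)))⁻¹ • LinearMap.proj i)
  let ε := WithLp.linearEquiv 2 ℝ (Fin (sigNeg Q) → ℝ)
  let L := LinearMap.toContinuousLinearMap (ε.symm.toLinearMap ∘ₗ L₀)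
  let s := LinearMap.toContinuousLinearMap (s₀ ∘ₗ ε.toLinearMap)
  have hL : ∀ v i, L v i = √(-w (κ i)) * φ v (κ i) := fun v i => rfl
  have hs : ∀ e, φ (s e) = ∑ i, Pi.single (κ i : Fin _) ((√(-w (κ i)))⁻¹ * e i) := by
    intro e
    have : φ (s e) = (∑ i, LinearMap.single ℝ (fun _ => ℝ) (κ i : Fin _) ∘ₗ
      ((√(-w (κ i)))⁻¹ • LinearMap.proj i)) (ε e) := φ.toLinearEquiv.apply_symm_apply _
    rw [this, LinearMap.sum_apply]
    rfl
  have hs1 : ∀ e i, φ (s e) (κ i) = (√(-w (κ i)))⁻¹ * e i := by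
    intro e i
    rw [hs, Finset.sum_apply, Finset.sum_eq_single i]
    · simp
    · intro j _ hj
      exact Pi.single_eq_of_ne (fun h => hj (κ.injective (Subtype.ext h.symm))) _
    · simp
  have hs2 : ∀ e, ∀ j, ¬ w j < 0 → φ (s e) j = 0 := by
    intro e j hj
    rw [hs, Finset.sum_apply]
    refine Finset.sum_eq_zero fun i _ => Pi.single_eq_of_ne (fun h => hj ?_) _
    rw [h]
    exact (κ i).2
  have hsum : ∀ v, Q v + ‖L v‖ ^ 2 = ∑ i with ¬ w i < 0, w i * φ v i ^ 2 := by
    intro v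
    have h1 : Q v = ∑ i, w i * φ v i ^ 2 := by
      rw [← φ.map_app v, QuadraticMap.weightedSumSquares_apply]
      simp only [smul_eq_mul, sq]
    have h2 : ‖L v‖ ^ 2 = - ∑ i with w i < 0, w i * φ v i ^ 2 := by
      rw [EuclideanSpace.norm_sq_eq, Finset.sum_subtype (p := fun i => i ∈ {i | w i < 0}) _
        (fun i => by simp), ← Equiv.sum_comp κ, ← Finset.sum_neg_distrib]
      refine Finset.sum_congr rfl fun i _ => ?_
      rw [hL, Real.norm_eq_abs, sq_abs, mul_pow, Real.sq_sqrt (neg_pos.2 (κ i).2).le, neg_mul]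
    rw [h1, h2, ← Finset.sum_filter_add_sum_filter_not _ (fun i => w i < 0)]
    ring
  refine ⟨L, s, fun e => ?_, fun v => ?_, fun v e => ?_⟩
  · ext i
    rw [hL, hs1, mul_inv_cancel_left₀ (hκ i).ne']
  · rw [hsum]
    exact Finset.sum_nonneg fun i hi =>
      mul_nonneg (not_lt.1 (Finset.mem_filter.1 hi).2) (sq_nonneg _)
  · rw [hsum, hsum]
    refine Finset.sum_congr rfl fun i hi => ?_
    rw [map_add, Pi.add_apply, hs2 e i (Finset.mem_filter.1 hi).2, add_zero]

variable {E : Type} [NormedAddCommGroup E] [NormedSpace ℝ E] {Q : QuadraticForm ℝ V}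
  {L : V →L[ℝ] E} {s : E →L[ℝ] V}

lemma IsNegativeSplitting.apply_section_eq (h : IsNegativeSplitting Q L s) (e : E) :
    Q (s e) = -‖e‖ ^ 2 := by
  have := h.map_add_section 0 e
  simp only [zero_add, h.apply_section, map_zero, norm_zero] at this
  linarith

/-- Strict and nonstrict sublevel sets of a quadratic form at negative levels look like the
exterior of a ball. -/
theorem IsNegativeSplitting.isExteriorLike (h : IsNegativeSplitting Q L s) {A : Set V} {b : ℝ}
    (hb : 0 < b) (hA : ∀ v ∈ A, Q v ≤ -b) (hA' : ∀ v ∈ A, ∀ w, Q w ≤ Q v → w ∈ A)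
    (hA'' : ∀ v, Q v < -b → v ∈ A) : IsExteriorLike L s A where
  exists_le_norm := by
    refine ⟨√b, Real.sqrt_pos.2 hb, fun v hv => Real.sqrt_le_iff.2 ⟨norm_nonneg _, ?_⟩⟩
    linarith [hA v hv, h.nonneg v]
  mem_of_norm_le v hv t ht e hle := by
    refine hA' v hv _ ?_
    -- The value of `Q` at the moved point is `(1 - t)² (Q v + ‖L v‖²)` minus the squared norm of
    -- its `L`-component, hence at most `Q v`.
    have h1 := h.map_add_section ((1 - t) • v) (t • e)
    rw [QuadraticMap.map_smul, map_add L, h.apply_section, map_smul, map_smul, norm_smul,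
      mul_pow, Real.norm_eq_abs, sq_abs, smul_eq_mul, ← sq] at h1
    have h2 : ‖L v‖ ^ 2 ≤ ‖(1 - t) • L v + t • e‖ ^ 2 := by gcongr
    have h3 : (1 - t) ^ 2 ≤ 1 := by nlinarith [ht.1, ht.2]
    nlinarith [mul_nonneg (sub_nonneg.2 h3) (h.nonneg v)]
  exists_mem_of_le_norm := by
    refine ⟨√b + 1, fun e he => hA'' _ ?_⟩
    rw [h.apply_section_eq]
    nlinarith [Real.sq_sqrt hb.le, Real.sqrt_nonneg b]

/-- Stated by inequalities so that both closed sublevel sets of `Q` and open ones of `-Q` qualify.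
Only `A` and `B'` are constrained, as the vanishing concerns that pair alone. -/
theorem RelSurjective.of_int_quadratic [FiniteDimensional ℝ V] (Q : QuadraticForm ℝ V) {b : ℝ}
    (hb : 0 < b) {A B B' : Set V} (hA : ∀ v ∈ A, Q v ≤ -b) (hA' : ∀ v ∈ A, ∀ w, Q w ≤ Q v → w ∈ A)
    (hA'' : ∀ v, Q v < -b → v ∈ A) (hB' : ∀ v, Q v < b → v ∈ B')
    (hB'' : ∀ v ∈ B', ∀ t ∈ Set.Icc (0 : ℝ) 1, t • v ∈ B')
    (R : Type u) [Ring R] (h : RelSurjective ℤ A B B' (sigNeg Q)) :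
    RelSurjective R A B B' (sigNeg Q) := by
  obtain ⟨L, s, hLs⟩ := exists_isNegativeSplitting Q
  have hE := hLs.isExteriorLike hb hA hA' hA''
  revert L s h
  generalize sigNeg Q = l
  intro h L s _ hE
  cases l with
  | zero => exact h.of_int_zero
  | succ k =>
    exact h.of_int_succ fun d hd hdA => hE.exists_sub_boundary_mem ℤ
      (fun v hv => hB' v (by linarith [hA v hv]))
      (starConvex_zero_iff.2 fun v hv t h0 h1 => hB'' v hv t ⟨h0, h1⟩)
      finrank_euclideanSpace_fin.symm d hd hdA

end Quadratic

/-! ### Passage from `Q` to `f`, for minmax and maxmin. -/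

section QuadraticAtInfinity

variable {n : ℕ} {f : EuclideanSpace ℝ (Fin n) → ℝ} {Q : QuadraticForm ℝ (EuclideanSpace ℝ (Fin n))}

lemma smul_apply_le_of_mem_Icc {V : Type} [AddCommGroup V] [Module ℝ V] (Q : QuadraticForm ℝ V)
    {v : V} {t : ℝ} (ht : t ∈ Set.Icc (0 : ℝ) 1) : Q (t • v) ≤ max 0 (Q v) := by
  rw [QuadraticMap.map_smul, smul_eq_mul]
  have h1 : t * t ≤ 1 := by nlinarith [ht.1, ht.2]
  calc t * t * Q v ≤ t * t * max 0 (Q v) :=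
        mul_le_mul_of_nonneg_left (le_max_right _ _) (mul_self_nonneg t)
    _ ≤ max 0 (Q v) := mul_le_of_le_one_left (le_max_left _ _) h1

lemma continuous_quadraticForm {V : Type} [NormedAddCommGroup V] [NormedSpace ℝ V]
    [FiniteDimensional ℝ V] (Q : QuadraticForm ℝ V) : Continuous Q := by
  obtain ⟨w, ⟨φ⟩⟩ := QuadraticForm.equivalent_weightedSumSquares Q
  have h : (Q : V → ℝ) = fun v => ∑ i, w i • (φ v i * φ v i) :=
    funext fun v => by rw [← φ.map_app v, QuadraticMap.weightedSumSquares_apply]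
  have hφ : Continuous φ := φ.toLinearEquiv.toLinearMap.continuous_of_finiteDimensional
  rw [h]
  fun_prop

/-- Take `b` above the bounds of `|f|` and `|Q|` on the compact set: there the comparisons with `±b`
agree for both functions, and elsewhere `f = Q`. -/
lemma IsQuadraticAtInfinity.eventually_sublevel_eq (hf : IsQuadraticAtInfinity f Q) :
    ∀ᶠ b : ℝ in atTop, sublevel f b = {x | Q x ≤ b} ∧ sublevel f (-b) = {x | Q x ≤ -b} := by
  obtain ⟨K, hK, hfK⟩ := hf.eq_outside
  have hQ : Continuous Q := continuous_quadraticForm Q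
  obtain ⟨M, hM⟩ := hK.exists_bound_of_continuousOn hf.continuous.continuousOn
  obtain ⟨N, hN⟩ := hK.exists_bound_of_continuousOn hQ.continuousOn
  filter_upwards [eventually_gt_atTop M, eventually_gt_atTop N] with b hMb hNb
  have key : ∀ x, (f x ≤ b ↔ Q x ≤ b) ∧ (f x ≤ -b ↔ Q x ≤ -b) := by
    intro x
    by_cases hx : x ∈ K
    · have h1 := abs_le.1 (hM x hx)
      have h2 := abs_le.1 (hN x hx)
      constructor
      · exact iff_of_true (by linarith) (by linarith)
      · exact iff_of_false (by linarith) (by linarith)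
    · rw [hfK x hx]
      exact ⟨Iff.rfl, Iff.rfl⟩
  exact ⟨Set.ext fun x => (key x).1, Set.ext fun x => (key x).2⟩

lemma sub_sigNeg_eq (hQ : Q.Nondegenerate) : n - sigNeg Q = sigNeg (-Q) := by
  have h := QuadraticForm.sigPos_add_sigNeg_add_radical (Q := Q)
  rw [hQ.radical_eq_bot, finrank_bot, finrank_euclideanSpace_fin] at h
  rw [sigNeg_neg]
  exact Nat.sub_eq_of_eq_add h.symm

theorem IsQuadraticAtInfinity.minmaxLevels_subset (hf : IsQuadraticAtInfinity f Q) (R : Type u)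
    [Ring R] : minmaxLevels ℤ (sigNeg Q) f ⊆ minmaxLevels R (sigNeg Q) f := by
  intro c hc
  filter_upwards [hc, hf.eventually_sublevel_eq, eventually_gt_atTop 0] with b hb hfb hb0
  obtain ⟨h₁, h₂, h⟩ := hb
  refine ⟨h₁, h₂, ?_⟩
  rw [surjective_relHomologyMap_iff] at h ⊢
  refine h.of_int_quadratic Q hb0 ?_ ?_ ?_ ?_ ?_ R
  all_goals simp only [hfb, Set.mem_ofPred_eq]
  · exact fun v => id
  · exact fun v hv w hw => hw.trans hv
  · exact fun v => le_of_lt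
  · exact fun v => le_of_lt
  · exact fun v hv t ht => (smul_apply_le_of_mem_Icc Q ht).trans (max_le hb0.le hv)

/-- For large `b`, the complements of `f ^ b` and `f ^ (-b)` are the strict sublevel sets of `-Q` at
`-b` and `b`, and nondegeneracy makes the degree the index of `-Q`. -/
theorem IsQuadraticAtInfinity.maxminLevels_subset (hf : IsQuadraticAtInfinity f Q) (R : Type u)
    [Ring R] : maxminLevels ℤ (n - sigNeg Q) f ⊆ maxminLevels R (n - sigNeg Q) f := by
  rw [sub_sigNeg_eq hf.nondegenerate]
  intro c hc
  filter_upwards [hc, hf.eventually_sublevel_eq, eventually_gt_atTop 0] with b hb hfb hb0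
  obtain ⟨h₁, h₂, h⟩ := hb
  refine ⟨h₁, h₂, ?_⟩
  rw [surjective_relHomologyMap_iff] at h ⊢
  refine h.of_int_quadratic (-Q) hb0 ?_ ?_ ?_ ?_ ?_ R
  all_goals simp only [hfb, Set.mem_compl_iff, Set.mem_ofPred_eq, not_le, neg_apply,
    neg_le_neg_iff, neg_lt_neg_iff]
  · exact fun v => le_of_lt
  · exact fun v hv w hw => hv.trans_le hw
  · exact fun v => id
  · exact fun v hv => neg_lt.1 hv
  · intro v hv t ht
    have := smul_apply_le_of_mem_Icc (-Q) (v := v) ht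
    rw [neg_apply, neg_apply] at this
    have := this.trans_lt (max_lt hb0 (neg_lt.1 hv))
    exact neg_lt.1 this

end QuadraticAtInfinity

end MinMax

theorem proposition2p11 {n : ℕ} (f : EuclideanSpace ℝ (Fin n) → ℝ)
    (Q : QuadraticForm ℝ (EuclideanSpace ℝ (Fin n)))
    (hf : MinMax.IsQuadraticAtInfinity f Q) (R : Type u) [Ring R] :
    MinMax.minmax R Q f ≤ MinMax.minmax ℤ Q f ∧
      MinMax.maxmin ℤ Q f ≤ MinMax.maxmin R Q f :=
  ⟨sInf_le_sInf (Set.image_mono (hf.minmaxLevels_subset R)),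
    sSup_le_sSup (Set.image_mono (hf.maxminLevels_subset R))⟩
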